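/- **Setting.** Distances and sensitivities take values in $[0,\infty]$; the distance $\infty$ is also written $\bot$. Truncated subtraction is used, with $\infty-\infty=0$. For sensitivities $s,s'$ put $s\diamond s'=\infty$ if $s=\infty$ or $s'=\infty$, and $s\diamond s'=ss'$ otherwise; for a sensitivity $s$ and a distance $d$ put $s\diamond\bot=\bot$, $\infty\diamond 0=0$, $\infty\diamond d=\bot$ for $0<d<\bot$, and $s\diamond d=sd$ otherwise. *DFuzz (terminating fragment, probabilities over $\mathbb R$ only).* Kinds are $\mathrm n$ (values in $\mathbb N$) and $\mathrm r$ (values in $[0,\infty]$); sizes $S::=i\mid 0\mid S+1$; sensitivities $R::=i\mid S\mid r\in\mathbb R^{\ge0}\mid\infty\mid R+R\mid R\cdot R$ (the product is interpreted by $\diamond$). Types are $\sigma,\tau::=\mathbb R\mid\mathbb R[R]\mid \mathrm{list}(\sigma)[S]\mid {!_R}\sigma\multimap\tau\mid\forall i{:}\kappa.\,\sigma\mid\mathfrak M\mathbb R$. Expressions are variables, constants $r\ge 0$, $\lambda x.e$, $e_1e_2$, $\mathbf{letrec}\,f\,x.\,e$, $\mathbf{letrec}\,f\,i.\,e$ ($i$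 an index variable), $\Lambda i.e$, $e[R]$, list constructors, $\mathbf{case}\ e\ [\mathrm{nil}\Rightarrow e_1\mid x{::}xs_{[i]}\Rightarrow e_2]$, $\mathbf{return}\,e$ and monadic $\mathbf{let}\ x=e_1\ \mathbf{in}\ e_2$. Judgments $\phi;\Phi;\Gamma\vdash_D e:\sigma$ have index variables $\phi$, size equations $\Phi$ and an environment $\Gamma$ of bindings $x:{!_R}\sigma$; $R\cdot\Gamma$ multiplies all sensitivities by $R$, and $\Gamma+\Gamma'$ adds the sensitivities of common variables (with the same type) and keeps the others. The rules are: - $\Gamma,x:{!_1}\sigma\vdash x:\sigma$; $\ \vdash r:\mathbb R[r]$; $\ \vdash \mathrm{nil}:\mathrm{list}(\sigma)[0]$; from $\Gamma\vdash e_1:\sigma$ and $\Gamma'\vdash e_2:\mathrm{list}(\sigma)[S]$ infer $\Gamma+\Gamma'\vdash e_1{::}e_2:\mathrm{list}(\sigma)[S+1]$; - from $\Gamma,x:{!_R}\sigma\vdash e:\tau$ infer $\Gamma\vdash\lambda x.e:{!_R}\sigma\multimap\tau$; from $\Gamma\vdash e_1:{!_R}\sigma\multimap\tau$ and $\Gamma'\vdash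 e_2:\sigma$ infer $\Gamma+R\cdot\Gamma'\vdash e_1e_2:\tau$; - from $\Gamma,f:{!_\infty}({!_R}\sigma\multimap\tau),x:{!_R}\sigma\vdash e:\tau$ infer $\infty\cdot\Gamma\vdash\mathbf{letrec}\,f\,x.\,e:{!_R}\sigma\multimap\tau$; from $\phi,i{:}\kappa;\Phi;\Gamma,f:{!_\infty}(\forall i{:}\kappa.\sigma)\vdash e:\sigma$ infer $\phi;\Phi;\infty\cdot\Gamma\vdash\mathbf{letrec}\,f\,i.\,e:\forall i{:}\kappa.\sigma$; in both cases the type of $f$ is required to have an element at distance $0$ from itself (whenever $\Phi$ holds); - from $\phi,i{:}\kappa;\Phi;\Gamma\vdash e:\sigma$ ($i$ fresh) infer $\Gamma\vdash\Lambda i.e:\forall i{:}\kappa.\sigma$; from $\Gamma\vdash e:\forall i{:}\kappa.\sigma$ infer $\Gamma\vdash e[S]:\sigma[S/i]$ for $S$ of kind $\kappa$; - from $\Gamma\vdash e:\mathbb R$ infer $\infty\cdot\Gamma\vdash\mathbf{return}\,e:\mathfrak M\mathbb R$; from $\Gamma\vdash e_1:\mathfrak M\mathbb R$ and $\Gamma',x:{!_\infty}\mathbb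 R\vdash e_2:\mathfrak M\mathbb R$ infer $\Gamma+\Gamma'\vdash\mathbf{let}\ x=e_1\ \mathbf{in}\ e_2:\mathfrak M\mathbb R$; - from $\phi;\Phi;\Gamma'\vdash e:\mathrm{list}(\sigma)[S]$, $\ \phi;\Phi,S=0;\Gamma\vdash e_1:\tau$ and $\ \phi,i{:}\mathrm n;\Phi,S=i+1;\Gamma,x:{!_R}\sigma,xs:{!_R}\mathrm{list}(\sigma)[i]\vdash e_2:\tau$ infer $\Gamma+R\cdot\Gamma'\vdash\mathbf{case}\ e\ [\mathrm{nil}\Rightarrow e_1\mid x{::}xs_{[i]}\Rightarrow e_2]:\tau$; - subsumption: the type may be replaced by a supertype, the types in $\Gamma$ by subtypes, sensitivities in $\Gamma$ may be increased and variables added. Subtyping, under $\Phi$, is the reflexive, transitive closure of: $\mathbb R[R]\sqsubseteq\mathbb R$, $\mathbb R[R]\sqsubseteq\mathbb R[R']$ if $R=R'$; lists covariant with equal sizes; ${!_R}\sigma\multimap\tau\sqsubseteq{!_{R'}}\sigma'\multimap\tau'$ if $R\le R'$, $\sigma'\sqsubseteq\sigma$, $\tau\sqsubseteq\tau'$; $\forall$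 covariant. *Distances.* Let $|\sigma|$ be the simple type obtained by erasing indices, interpreted set-theoretically ($\mathfrak M A$ is the set of discrete probability distributions on $A$). On it, $\mathcal D_{\mathbb R}(a,b)=|a-b|$; $\mathcal D_{\mathbb R[R]}(a,b)=0$ if $a=b=R$, else $\bot$; $\mathcal D_{\mathrm{list}(\sigma)[S]}(l,l')=\sum_j\mathcal D_\sigma(l_j,l'_j)$ if both lists have length $S$, else $\bot$; $\mathcal D_{!_R\sigma\multimap\tau}(f,g)=\sup_{a,b}\bigl(\mathcal D_\tau(f a,g b)-R\diamond\mathcal D_\sigma(a,b)\bigr)$; $\mathcal D_{\forall i:\kappa.\sigma}(f,g)=\sup_{d\in\kappa}\mathcal D_{\sigma[d/i]}(f d,g d)$; $\mathcal D_{\mathfrak M\mathbb R}(\mu,\nu)=\sup_x|\ln(\mu(x)/\nu(x))|$ (with $0$ at points where both vanish and $\infty$ where exactly one does). *HOARe².* A $\lambda$-calculus with lists, guarded recursion and discrete probability monad, whose relational types are base types, $\mathfrak M_{\varepsilon,\delta}[T]$, $\Pi(x::T).U$ and refinements $\{x::T\mid\varphi\}$ by assertions over left and right instances $x_\triangleleft,x_\triangleright$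 of variables. A relational type is interpreted as a relation on its erasure; $\mathfrak M_{\varepsilon,\delta}[T]$ relates $\mu_1,\mu_2$ iff there is a sub-distribution $\mu$ on the product, supported in the relation $T$, with marginals $\pi_j\mu\le\mu_j$ and $\sup_E\bigl(\mu_j(E)-e^\varepsilon(\pi_j\mu)(E)\bigr)\le\delta$ for $j=1,2$. The judgment $\mathcal G\vdash e::T$ (i.e. $\mathcal G\vdash e\sim e::T$) is *derivability* by the syntax-directed rules for variables, constants, abstraction, application, let, recursion, conditionals, list case, unit and bind, the asynchronous reduction and case rules, and subsumption along semantic subtyping (inclusion of the interpretations under all valuations validating $\mathcal G$). Recursion is guarded: a recursive definition must have, in every valuation, a fixed point that is the limit of the iterates of its functional from any starting function, and it is typed with a decreasing size measure on the argument. *Translation.* $(\mathbb R)^*=\mathbb R$, $(\mathbb R[R])^*=\{x::\mathbb R\mid x_\triangleleft=x_\triangleright=R^*\}$, $(\mathrm{list}(\sigma)[S])^*=\{x::\mathrm{list}(|\sigma|)\mid \mathsf{sz}(x_\triangleleft)=\mathsf{sz}(x_\triangleright)=S^*\}$, $({!_R}\sigma\multimap\tau)^*=\sigma^*\to\tau^*$,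 $(\forall i{:}\kappa.\sigma)^*=\Pi(i::\{x::\kappa^*\mid x_\triangleleft=x_\triangleright\}).\sigma^*$, $(\mathfrak M\mathbb R)^*=\mathfrak M_{0,0}[\mathbb R]$. Expressions are translated homomorphically, with $(\Lambda i.e)^*=\lambda i.e^*$, $(e[S])^*=e^*\,S^*$, and with $i$ replaced by $\mathsf{sz}(xs)$ in the second branch of a case. **Theorem.** Let $\varepsilon$ be a closed sensitivity with finite value (a non-negative real), $\tau$ a closed DFuzz type and $e$ a DFuzz expression that terminates, in the sense that every recursive definition in $e^*$ passes the termination guard above. If $$\emptyset;\emptyset;x:{!_\varepsilon}\tau\vdash_D e:\mathfrak M\mathbb R,$$ then $$x::\{x::\tau^*\mid \mathcal D_\tau(x_\triangleleft,x_\triangleright)\le 1\}\ \vdash\ e^*::\mathfrak M_{\varepsilon,0}\bigl[\{y::\mathbb R\mid y_\triangleleft=y_\triangleright\}\bigr]$$ is derivable in HOARe². Moreover the program is $\varepsilon$-differentially private for the adjacency relation $\mathcal D_\tau\le 1$: for all $v_1,v_2\in|\tau|$ with $\mathcal D_\tau(v_1,v_2)\le 1$ and all $E\subseteq\mathbb R$,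 $$\Pr\bigl[[\![e^*]\!](v_1)\in E\bigr]\ \le\ e^{\varepsilon}\,\Pr\bigl[[\![e^*]\!](v_2)\in E\bigr].$$ -/

import Mathlib

open Filter
open scoped ENNReal NNReal

namespace HOARe

/-! ## Variables, simple types and their interpretation -/

/-- Well-scoped, well-typed de Bruijn variables of a context `Γ` (head of the list = last bound). -/
inductive Var {α : Type} : List α → α → Type
  | z {Γ : List α} {A : α} : Var (A :: Γ) A
  | s {Γ : List α} {A B : α} : Var Γ A → Var (B :: Γ) A

/-- Simple types. -/
inductive Ty : Type
  | unit
  | bool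
  | nat
  | real
  | ereal
  | list (A : Ty)
  | M (A : Ty)
  | fn (A B : Ty)

/-- Core types (base types and inductive types). -/
def Ty.IsCore : Ty → Prop
  | .M _ => False
  | .fn _ _ => False
  | _ => True

/-- Set-theoretic interpretation of simple types; `ereal` is `[0, ∞]`, and `M A` is the set of
discrete probability distributions on `A`. -/
def Ty.den : Ty → Type
  | .unit => Unit
  | .bool => Bool
  | .nat => ℕ
  | .real => ℝ
  | .ereal => ℝ≥0∞
  | .list A => List A.den
  | .M A => PMF A.den
  | .fn A B => A.den → B.den

theorem Ty.den_nonempty : (A : Ty) → Nonempty A.den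
  | .unit => ⟨()⟩
  | .bool => ⟨true⟩
  | .nat => ⟨(0 : ℕ)⟩
  | .real => ⟨(0 : ℝ)⟩
  | .ereal => ⟨(0 : ℝ≥0∞)⟩
  | .list _ => ⟨([] : List _)⟩
  | .M A => (Ty.den_nonempty A).elim fun a => ⟨PMF.pure a⟩
  | .fn _ B => (Ty.den_nonempty B).elim fun b => ⟨fun _ => b⟩

instance (A : Ty) : Nonempty A.den := A.den_nonempty

/-- Valuations of a context. -/
def Env (Γ : List Ty) : Type := (A : Ty) → Var Γ A → A.den

def Env.nil : Env [] := fun _ v => nomatch v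

def Env.cons {Γ : List Ty} {A : Ty} (d : A.den) (θ : Env Γ) : Env (A :: Γ)
  | _, .z => d
  | _, .s v => θ _ v

def Env.tail {Γ : List Ty} {A : Ty} (θ : Env (A :: Γ)) : Env Γ := fun B v => θ B v.s

/-! ## Index terms of DFuzz: kinds, sizes, sensitivities -/

/-- Kinds: sizes `n` and sensitivities `r`. -/
inductive Kind : Type
  | n
  | r

/-- Simple type of the values of a kind. -/
def Kind.ty : Kind → Ty
  | .n => .nat
  | .r => .ereal

/-- Sizes `S ::= i | 0 | S + 1`. -/
inductive Size (φ : List Kind) : Type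
  | var (i : Var φ .n)
  | zero
  | succ (S : Size φ)

/-- Sensitivities `R ::= i | S | r | ∞ | R + R | R · R`. -/
inductive Sens (φ : List Kind) : Type
  | var (i : Var φ .r)
  | size (S : Size φ)
  | const (r : ℝ≥0)
  | infty
  | add (R₁ R₂ : Sens φ)
  | mul (R₁ R₂ : Sens φ)

/-- Index terms of a given kind. -/
def Idx (φ : List Kind) : Kind → Type
  | .n => Size φ
  | .r => Sens φ

def Idx.var {φ : List Kind} : (κ : Kind) → Var φ κ → Idx φ κ
  | .n, i => Size.var i
  | .r, i => Sens.var i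

/-- Valuations of index variables. -/
def IEnv (φ : List Kind) : Type := (κ : Kind) → Var φ κ → κ.ty.den

def IEnv.nil : IEnv [] := fun _ i => nomatch i

def IEnv.cons {φ : List Kind} {κ : Kind} (d : κ.ty.den) (ρ : IEnv φ) : IEnv (κ :: φ)
  | _, .z => d
  | _, .s i => ρ _ i

/-- The product `s ⋄ s'` of two sensitivities: `s ⋄ ∞ = ∞ ⋄ s = ∞`, also for `s = 0`. -/
noncomputable def smul (s t : ℝ≥0∞) : ℝ≥0∞ :=
  open Classical in if s = ⊤ ∨ t = ⊤ then ⊤ else s * t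

/-- The product `s ⋄ d` of a sensitivity and a distance (the distance `⊥` is represented by `⊤`):
`s ⋄ ⊥ = ⊥`, also for `s = 0`; `∞ ⋄ 0 = 0`, and `∞ ⋄ d = ⊥` for `d ≠ 0`. -/
noncomputable def dmul (s d : ℝ≥0∞) : ℝ≥0∞ :=
  open Classical in if d = ⊤ then ⊤ else s * d

def Size.den {φ : List Kind} (ρ : IEnv φ) : Size φ → ℕ
  | .var i => ρ .n i
  | .zero => 0
  | .succ S => S.den ρ + 1

noncomputable def Sens.den {φ : List Kind} (ρ : IEnv φ) : Sens φ → ℝ≥0∞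
  | .var i => ρ .r i
  | .size S => (S.den ρ : ℝ≥0∞)
  | .const r => (r : ℝ≥0∞)
  | .infty => ⊤
  | .add R₁ R₂ => R₁.den ρ + R₂.den ρ
  | .mul R₁ R₂ => smul (R₁.den ρ) (R₂.den ρ)

/-- Substitutions of index terms for index variables. -/
def ISub (φ ψ : List Kind) : Type := (κ : Kind) → Var φ κ → Idx ψ κ

def Size.subst {φ ψ : List Kind} (s : ISub φ ψ) : Size φ → Size ψ
  | .var i => s .n i
  | .zero => .zero
  | .succ S => .succ (S.subst s)

def Sens.subst {φ ψ : List Kind} (s : ISub φ ψ) : Sens φ → Sens ψ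
  | .var i => s .r i
  | .size S => .size (S.subst s)
  | .const r => .const r
  | .infty => .infty
  | .add R₁ R₂ => .add (R₁.subst s) (R₂.subst s)
  | .mul R₁ R₂ => .mul (R₁.subst s) (R₂.subst s)

def ISub.wk {φ : List Kind} {κ : Kind} : ISub φ (κ :: φ) := fun κ' i => Idx.var κ' i.s

def Idx.subst {φ ψ : List Kind} (s : ISub φ ψ) : (κ : Kind) → Idx φ κ → Idx ψ κ
  | .n, S => Size.subst s S
  | .r, R => Sens.subst s R

def ISub.lift {φ ψ : List Kind} {κ : Kind} (s : ISub φ ψ) : ISub (κ :: φ) (κ :: ψ)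
  | _, .z => Idx.var _ .z
  | κ', .s i => (s κ' i).subst ISub.wk

/-- The substitution `[S / i]` for the last bound index variable. -/
def ISub.inst {φ : List Kind} {κ : Kind} (S : Idx φ κ) : ISub (κ :: φ) φ
  | _, .z => S
  | κ', .s i => Idx.var κ' i

/-! ## DFuzz types and their metric -/

/-- DFuzz types over the index variables `φ`; the second index is the erasure of the type to a
simple type. -/
inductive DTy : List Kind → Ty → Type
  | real {φ : List Kind} : DTy φ .real
  | realS {φ : List Kind} (R : Sens φ) : DTy φ .real
  | list {φ : List Kind} {A : Ty} (σ : DTy φ A) (S : Size φ) : DTy φ (.list A)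
  | lolli {φ : List Kind} {A B : Ty} (R : Sens φ) (σ : DTy φ A) (τ : DTy φ B) : DTy φ (.fn A B)
  | all {φ : List Kind} {A : Ty} (κ : Kind) (σ : DTy (κ :: φ) A) : DTy φ (.fn κ.ty A)
  | M {φ : List Kind} : DTy φ (.M .real)

def DTy.subst {φ ψ : List Kind} {A : Ty} (s : ISub φ ψ) (σ : DTy φ A) : DTy ψ A :=
  match σ with
  | .real => .real
  | .realS R => .realS (R.subst s)
  | .list σ S => .list (σ.subst s) (S.subst s)
  | .lolli R σ τ => .lolli (R.subst s) (σ.subst s) (τ.subst s)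
  | .all κ σ => .all κ (σ.subst s.lift)
  | .M => .M

/-- `|ln (a / b)|` with values in `[0, ∞]`; it is `0` if `a = b = 0`, and `∞` if only one of the
two is `0`. Used for `a, b < ∞`. -/
noncomputable def absLogRatio (a b : ℝ≥0∞) : ℝ≥0∞ :=
  open Classical in
    if a = b then 0
    else if a = 0 ∨ b = 0 then ⊤
    else ENNReal.ofReal |Real.log (a.toReal / b.toReal)|

/-- The distance `D_σ`, with values in `[0, ∞]` (`⊤` stands for `⊥`). Subtraction is the
truncated one, and `⊤ - ⊤ = 0`. -/
noncomputable def DTy.D {φ : List Kind} {A : Ty} (σ : DTy φ A) (ρ : IEnv φ) :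
    A.den → A.den → ℝ≥0∞ :=
  match σ with
  | .real => fun (d₁ d₂ : ℝ) => ENNReal.ofReal |d₁ - d₂|
  | .realS R => fun (d₁ d₂ : ℝ) =>
      open Classical in if d₁ = d₂ ∧ 0 ≤ d₂ ∧ ENNReal.ofReal d₂ = R.den ρ then 0 else ⊤
  | .list (A := A) σ S => fun (d₁ d₂ : List A.den) =>
      open Classical in
        if d₁.length = S.den ρ ∧ d₂.length = S.den ρ then (List.zipWith (σ.D ρ) d₁ d₂).sum else ⊤
  | .lolli (A := A) (B := B) R σ τ => fun (d₁ d₂ : A.den → B.den) =>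
      ⨆ (d₃ : A.den) (d₄ : A.den), (τ.D ρ (d₁ d₃) (d₂ d₄) - dmul (R.den ρ) (σ.D ρ d₃ d₄))
  | .all (A := A) κ σ => fun (d₁ d₂ : κ.ty.den → A.den) =>
      ⨆ d : κ.ty.den, σ.D (ρ.cons d) (d₁ d) (d₂ d)
  | .M => fun (μ₁ μ₂ : PMF ℝ) => ⨆ x : ℝ, absLogRatio (μ₁ x) (μ₂ x)

/-! ## HOARe² expressions -/

/-- Constants and primitive operators. -/
inductive Prim : Ty → Type
  | unit : Prim .unit
  | bool (b : Bool) : Prim .bool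
  | nat (k : ℕ) : Prim .nat
  | real (r : ℝ) : Prim .real
  | ereal (r : ℝ≥0∞) : Prim .ereal
  | nil (A : Ty) : Prim (.list A)
  | cons (A : Ty) : Prim (.fn A (.fn (.list A) (.list A)))
  | size (A : Ty) : Prim (.fn (.list A) .nat)
  | succ : Prim (.fn .nat .nat)
  | natCast : Prim (.fn .nat .ereal)
  | ofReal : Prim (.fn .real .ereal)
  | add : Prim (.fn .ereal (.fn .ereal .ereal))
  | smul : Prim (.fn .ereal (.fn .ereal .ereal))

noncomputable def Prim.den : {A : Ty} → Prim A → A.den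
  | _, .unit => ()
  | _, .bool b => b
  | _, .nat k => k
  | _, .real r => r
  | _, .ereal r => r
  | _, .nil A => ([] : List A.den)
  | _, .cons A => fun (a : A.den) (l : List A.den) => a :: l
  | _, .size A => fun (l : List A.den) => l.length
  | _, .succ => fun (k : ℕ) => k + 1
  | _, .natCast => fun (k : ℕ) => (k : ℝ≥0∞)
  | _, .ofReal => fun (r : ℝ) => ENNReal.ofReal r
  | _, .add => fun (a b : ℝ≥0∞) => a + b
  | _, .smul => fun (a b : ℝ≥0∞) => HOARe.smul a b

/-- Expressions, in intrinsically simply typed form (Church style, de Bruijn variables).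
`letrec e` is the terminating recursive function `letrec↓ f x. e`, with `x` the last variable and
`f` the one before; in `case e e₁ e₂` the branch `e₂` binds the head, then the tail.
`dist σ s e₁ e₂` is the distance expression `D_σ(e₁, e₂)`, the index variables of `σ` being replaced
according to `s`; it is only used in assertions. -/
inductive Tm : List Ty → Ty → Type
  | var {Γ : List Ty} {A : Ty} (x : Var Γ A) : Tm Γ A
  | prim {Γ : List Ty} {A : Ty} (c : Prim A) : Tm Γ A
  | app {Γ : List Ty} {A B : Ty} (e₁ : Tm Γ (.fn A B)) (e₂ : Tm Γ A) : Tm Γ B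
  | lam {Γ : List Ty} {A B : Ty} (e : Tm (A :: Γ) B) : Tm Γ (.fn A B)
  | letE {Γ : List Ty} {A B : Ty} (e₁ : Tm Γ A) (e₂ : Tm (A :: Γ) B) : Tm Γ B
  | letrec {Γ : List Ty} {A B : Ty} (e : Tm (A :: .fn A B :: Γ) B) : Tm Γ (.fn A B)
  | ite {Γ : List Ty} {A : Ty} (e : Tm Γ .bool) (e₁ e₂ : Tm Γ A) : Tm Γ A
  | case {Γ : List Ty} {A B : Ty} (e : Tm Γ (.list A)) (e₁ : Tm Γ B)
      (e₂ : Tm (.list A :: A :: Γ) B) : Tm Γ B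
  | unitM {Γ : List Ty} {A : Ty} (e : Tm Γ A) : Tm Γ (.M A)
  | bindM {Γ : List Ty} {A B : Ty} (e₁ : Tm Γ (.M A)) (e₂ : Tm (A :: Γ) (.M B)) : Tm Γ (.M B)
  | dist {Γ : List Ty} {φ : List Kind} {A : Ty} (σ : DTy φ A)
      (s : (κ : Kind) → Var φ κ → Tm Γ κ.ty) (e₁ e₂ : Tm Γ A) : Tm Γ .ereal

def Tm.cons {Γ : List Ty} {A : Ty} (e₁ : Tm Γ A) (e₂ : Tm Γ (.list A)) : Tm Γ (.list A) :=
  .app (.app (.prim (.cons A)) e₁) e₂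

def Tm.size {Γ : List Ty} {A : Ty} (e : Tm Γ (.list A)) : Tm Γ .nat := .app (.prim (.size A)) e

def Tm.add {Γ : List Ty} (e₁ e₂ : Tm Γ .ereal) : Tm Γ .ereal := .app (.app (.prim .add) e₁) e₂

/-- Renamings. -/
def Ren (Γ Δ : List Ty) : Type := (A : Ty) → Var Γ A → Var Δ A

def Ren.wk {Γ : List Ty} {B : Ty} : Ren Γ (B :: Γ) := fun _ x => x.s

def Ren.lift {Γ Δ : List Ty} {B : Ty} (r : Ren Γ Δ) : Ren (B :: Γ) (B :: Δ)
  | _, .z => .z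
  | _, .s x => .s (r _ x)

def Tm.rename {Γ Δ : List Ty} {A : Ty} (r : Ren Γ Δ) (e : Tm Γ A) : Tm Δ A :=
  match e with
  | .var x => .var (r _ x)
  | .prim c => .prim c
  | .app e₁ e₂ => .app (e₁.rename r) (e₂.rename r)
  | .lam e => .lam (e.rename r.lift)
  | .letE e₁ e₂ => .letE (e₁.rename r) (e₂.rename r.lift)
  | .letrec e => .letrec (e.rename r.lift.lift)
  | .ite e e₁ e₂ => .ite (e.rename r) (e₁.rename r) (e₂.rename r)
  | .case e e₁ e₂ => .case (e.rename r) (e₁.rename r) (e₂.rename r.lift.lift)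
  | .unitM e => .unitM (e.rename r)
  | .bindM e₁ e₂ => .bindM (e₁.rename r) (e₂.rename r.lift)
  | .dist σ s e₁ e₂ => .dist σ (fun κ i => (s κ i).rename r) (e₁.rename r) (e₂.rename r)

def Tm.wk {Γ : List Ty} {A B : Ty} (e : Tm Γ A) : Tm (B :: Γ) A := e.rename Ren.wk

/-- Simultaneous substitutions. -/
def Sub (Γ Δ : List Ty) : Type := (A : Ty) → Var Γ A → Tm Δ A

def Sub.lift {Γ Δ : List Ty} {B : Ty} (s : Sub Γ Δ) : Sub (B :: Γ) (B :: Δ)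
  | _, .z => .var .z
  | _, .s x => (s _ x).wk

def Sub.id {Γ : List Ty} : Sub Γ Γ := fun _ x => .var x

def Sub.cons {Γ Δ : List Ty} {B : Ty} (e : Tm Δ B) (s : Sub Γ Δ) : Sub (B :: Γ) Δ
  | _, .z => e
  | _, .s x => s _ x

def Tm.subst {Γ Δ : List Ty} {A : Ty} (s : Sub Γ Δ) (e : Tm Γ A) : Tm Δ A :=
  match e with
  | .var x => s _ x
  | .prim c => .prim c
  | .app e₁ e₂ => .app (e₁.subst s) (e₂.subst s)
  | .lam e => .lam (e.subst s.lift)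
  | .letE e₁ e₂ => .letE (e₁.subst s) (e₂.subst s.lift)
  | .letrec e => .letrec (e.subst s.lift.lift)
  | .ite e e₁ e₂ => .ite (e.subst s) (e₁.subst s) (e₂.subst s)
  | .case e e₁ e₂ => .case (e.subst s) (e₁.subst s) (e₂.subst s.lift.lift)
  | .unitM e => .unitM (e.subst s)
  | .bindM e₁ e₂ => .bindM (e₁.subst s) (e₂.subst s.lift)
  | .dist σ t e₁ e₂ => .dist σ (fun κ i => (t κ i).subst s) (e₁.subst s) (e₂.subst s)

/-! ## Denotational semantics of expressions -/

/-- Convergence of approximations: eventually constant at non-functional types, pointwise at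
function types. -/
def Ty.Conv : (A : Ty) → (ℕ → A.den) → A.den → Prop
  | .fn A B, u, v => ∀ a : A.den, B.Conv (fun k => (u k : A.den → B.den) a) ((v : A.den → B.den) a)
  | _, u, v => ∀ᶠ k in atTop, u k = v

/-- `h` is the value of the terminating recursive definition with functional `F`: a fixed point
of `F` which is the limit of the iterates `F^k(g)`, whatever approximation `g` they start from. -/
def IsRec (A B : Ty) (F : (A.den → B.den) → A.den → B.den) (h : A.den → B.den) : Prop :=
  F h = h ∧ ∀ g : A.den → B.den, (Ty.fn A B).Conv (fun k => F^[k] g) h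

/-- Interpretation of expressions. -/
noncomputable def Tm.den {Γ : List Ty} {A : Ty} (e : Tm Γ A) (θ : Env Γ) : A.den :=
  match e with
  | .var x => θ _ x
  | .prim c => c.den
  | .app (A := A) (B := B) e₁ e₂ => (e₁.den θ : A.den → B.den) (e₂.den θ)
  | .lam (A := A) e => fun d : A.den => e.den (θ.cons d)
  | .letE e₁ e₂ => e₂.den (θ.cons (e₁.den θ))
  | .letrec (A := A) (B := B) e =>
      Classical.epsilon (α := A.den → B.den) (IsRec A B fun g d =>
        e.den (Env.cons d (Env.cons (A := .fn A B) g θ)))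
  | .ite e e₁ e₂ => match (e.den θ : Bool) with
      | true => e₁.den θ
      | false => e₂.den θ
  | .case (A := A) e e₁ e₂ => match (e.den θ : List A.den) with
      | [] => e₁.den θ
      | a :: l => e₂.den (Env.cons (A := .list A) l (Env.cons a θ))
  | .unitM (A := A) e => PMF.pure (e.den θ : A.den)
  | .bindM (A := A) (B := B) e₁ e₂ =>
      PMF.bind (e₁.den θ : PMF A.den) fun d => (e₂.den (θ.cons d) : PMF B.den)
  | .dist σ s e₁ e₂ => σ.D (fun κ i => (s κ i).den θ) (e₁.den θ) (e₂.den θ)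

/-- The termination guard of `letrec↓ f x. e`: in every valuation the definition has a value. -/
def Tm.SNGuard {Γ : List Ty} {A B : Ty} (e : Tm (A :: .fn A B :: Γ) B) : Prop :=
  ∀ θ : Env Γ, ∃ h : A.den → B.den,
    IsRec A B (fun g d => e.den (Env.cons d (Env.cons (A := .fn A B) g θ))) h

/-- Simple typing `Γ ⊢ e : A` of programs. Expressions being intrinsically typed, what remains to
be said is that every recursive definition passes the termination guard and that no distance
operator occurs. -/
def Tm.SimplyTyped {Γ : List Ty} {A : Ty} (e : Tm Γ A) : Prop :=
  match e with
  | .var _ => True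
  | .prim _ => True
  | .app e₁ e₂ => e₁.SimplyTyped ∧ e₂.SimplyTyped
  | .lam e => e.SimplyTyped
  | .letE e₁ e₂ => e₁.SimplyTyped ∧ e₂.SimplyTyped
  | .letrec e => e.SimplyTyped ∧ e.SNGuard
  | .ite e e₁ e₂ => e.SimplyTyped ∧ e₁.SimplyTyped ∧ e₂.SimplyTyped
  | .case e e₁ e₂ => e.SimplyTyped ∧ e₁.SimplyTyped ∧ e₂.SimplyTyped
  | .unitM e => e.SimplyTyped
  | .bindM e₁ e₂ => e₁.SimplyTyped ∧ e₂.SimplyTyped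
  | .dist _ _ _ _ => False

/-- Reduction of expressions (in evaluation contexts). -/
inductive Red : {Γ : List Ty} → {A : Ty} → Tm Γ A → Tm Γ A → Prop
  | beta {Γ : List Ty} {A B : Ty} (e : Tm (A :: Γ) B) (a : Tm Γ A) :
      Red (.app (.lam e) a) (e.subst (Sub.cons a Sub.id))
  | unfold {Γ : List Ty} {A B : Ty} (e : Tm (A :: .fn A B :: Γ) B) (a : Tm Γ A) :
      Red (.app (.letrec e) a) (e.subst (Sub.cons a (Sub.cons (.letrec e) Sub.id)))
  | letE {Γ : List Ty} {A B : Ty} (e₁ : Tm Γ A) (e₂ : Tm (A :: Γ) B) :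
      Red (.letE e₁ e₂) (e₂.subst (Sub.cons e₁ Sub.id))
  | iteTrue {Γ : List Ty} {A : Ty} (e₁ e₂ : Tm Γ A) :
      Red (.ite (.prim (.bool true)) e₁ e₂) e₁
  | iteFalse {Γ : List Ty} {A : Ty} (e₁ e₂ : Tm Γ A) :
      Red (.ite (.prim (.bool false)) e₁ e₂) e₂
  | caseNil {Γ : List Ty} {A B : Ty} (e₁ : Tm Γ B) (e₂ : Tm (.list A :: A :: Γ) B) :
      Red (.case (.prim (.nil A)) e₁ e₂) e₁
  | caseCons {Γ : List Ty} {A B : Ty} (a : Tm Γ A) (l : Tm Γ (.list A)) (e₁ : Tm Γ B)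
      (e₂ : Tm (.list A :: A :: Γ) B) :
      Red (.case (.cons a l) e₁ e₂) (e₂.subst (Sub.cons l (Sub.cons a Sub.id)))
  | bindUnit {Γ : List Ty} {A B : Ty} (a : Tm Γ A) (e : Tm (A :: Γ) (.M B)) :
      Red (.bindM (.unitM a) e) (e.subst (Sub.cons a Sub.id))
  | appL {Γ : List Ty} {A B : Ty} {f f' : Tm Γ (.fn A B)} (a : Tm Γ A) :
      Red f f' → Red (.app f a) (.app f' a)
  | appR {Γ : List Ty} {A B : Ty} (f : Tm Γ (.fn A B)) {a a' : Tm Γ A} :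
      Red a a' → Red (.app f a) (.app f a')
  | iteC {Γ : List Ty} {A : Ty} {e e' : Tm Γ .bool} (e₁ e₂ : Tm Γ A) :
      Red e e' → Red (.ite e e₁ e₂) (.ite e' e₁ e₂)
  | caseC {Γ : List Ty} {A B : Ty} {e e' : Tm Γ (.list A)} (e₁ : Tm Γ B)
      (e₂ : Tm (.list A :: A :: Γ) B) : Red e e' → Red (.case e e₁ e₂) (.case e' e₁ e₂)
  | unitC {Γ : List Ty} {A : Ty} {e e' : Tm Γ A} : Red e e' → Red (.unitM e) (.unitM e')
  | bindC {Γ : List Ty} {A B : Ty} {e e' : Tm Γ (.M A)} (e₂ : Tm (A :: Γ) (.M B)) :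
      Red e e' → Red (.bindM e e₂) (.bindM e' e₂)

/-! ## Relational types and assertions -/

/-- Numeric types, on which `≤` makes sense. -/
inductive Num : Type
  | nat
  | real
  | ereal

def Num.ty : Num → Ty
  | .nat => .nat
  | .real => .real
  | .ereal => .ereal

def Num.le : (N : Num) → N.ty.den → N.ty.den → Prop
  | .nat => fun (a b : ℕ) => a ≤ b
  | .real => fun (a b : ℝ) => a ≤ b
  | .ereal => fun (a b : ℝ≥0∞) => a ≤ b

mutual

/-- Relational types `T` whose erasure is the simple type given by the second index. They live in a
context of variable instances: a relational binder for `x` adds two variables, the left instance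
`x◁` (de Bruijn index 0) and the right instance `x▷` (de Bruijn index 1). -/
inductive RTy : List Ty → Ty → Type
  | core {Δ : List Ty} (A : Ty) (hA : A.IsCore) : RTy Δ A
  | M {Δ : List Ty} {A : Ty} (ε δ : Tm Δ .ereal) (T : RTy Δ A) : RTy Δ (.M A)
  | pi {Δ : List Ty} {A B : Ty} (T : RTy Δ A) (U : RTy (A :: A :: Δ) B) : RTy Δ (.fn A B)
  | ref {Δ : List Ty} {A : Ty} (T : RTy Δ A) (φ : Asrt (A :: A :: Δ)) : RTy Δ A

/-- Assertions: quantifiers over plain variables (`allP`, `exP`) and over relational variables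
(`allR`, `exR`), the usual connectives, and `=` and `≤` between relational expressions. -/
inductive Asrt : List Ty → Type
  | allP {Δ : List Ty} (A : Ty) (φ : Asrt (A :: Δ)) : Asrt Δ
  | exP {Δ : List Ty} (A : Ty) (φ : Asrt (A :: Δ)) : Asrt Δ
  | allR {Δ : List Ty} {A : Ty} (T : RTy Δ A) (φ : Asrt (A :: A :: Δ)) : Asrt Δ
  | exR {Δ : List Ty} {A : Ty} (T : RTy Δ A) (φ : Asrt (A :: A :: Δ)) : Asrt Δ
  | top {Δ : List Ty} : Asrt Δ
  | bot {Δ : List Ty} : Asrt Δ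
  | not {Δ : List Ty} (φ : Asrt Δ) : Asrt Δ
  | and {Δ : List Ty} (φ ψ : Asrt Δ) : Asrt Δ
  | or {Δ : List Ty} (φ ψ : Asrt Δ) : Asrt Δ
  | imp {Δ : List Ty} (φ ψ : Asrt Δ) : Asrt Δ
  | eq {Δ : List Ty} {A : Ty} (e₁ e₂ : Tm Δ A) : Asrt Δ
  | le {Δ : List Ty} (N : Num) (e₁ e₂ : Tm Δ N.ty) : Asrt Δ

end

def Asrt.iff {Δ : List Ty} (φ ψ : Asrt Δ) : Asrt Δ := .and (.imp φ ψ) (.imp ψ φ)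

mutual

def RTy.subst {Δ Δ' : List Ty} {A : Ty} (s : Sub Δ Δ') (T : RTy Δ A) : RTy Δ' A :=
  match T with
  | .core A hA => .core A hA
  | .M ε δ T => .M (ε.subst s) (δ.subst s) (T.subst s)
  | .pi T U => .pi (T.subst s) (U.subst s.lift.lift)
  | .ref T φ => .ref (T.subst s) (φ.subst s.lift.lift)

def Asrt.subst {Δ Δ' : List Ty} (s : Sub Δ Δ') (φ : Asrt Δ) : Asrt Δ' :=
  match φ with
  | .allP A φ => .allP A (φ.subst s.lift)
  | .exP A φ => .exP A (φ.subst s.lift)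
  | .allR T φ => .allR (T.subst s) (φ.subst s.lift.lift)
  | .exR T φ => .exR (T.subst s) (φ.subst s.lift.lift)
  | .top => .top
  | .bot => .bot
  | .not φ => .not (φ.subst s)
  | .and φ ψ => .and (φ.subst s) (ψ.subst s)
  | .or φ ψ => .or (φ.subst s) (ψ.subst s)
  | .imp φ ψ => .imp (φ.subst s) (ψ.subst s)
  | .eq e₁ e₂ => .eq (e₁.subst s) (e₂.subst s)
  | .le N e₁ e₂ => .le N (e₁.subst s) (e₂.subst s)

end

/-- `exp ε` for `ε ∈ [0, ∞]`. -/
noncomputable def eexp (ε : ℝ≥0∞) : ℝ≥0∞ :=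
  open Classical in if ε = ⊤ then ⊤ else ENNReal.ofReal (Real.exp ε.toReal)

/-- The `ε`-distance `Δ_ε(μ₁, μ₂) = sup_E (μ₁(E) - exp(ε) μ₂(E))` of two discrete
(sub-)distributions. (The supremum is at least `0`, because of `E = ∅`.) -/
noncomputable def epsDist {α : Type} (ε : ℝ≥0∞) (μ₁ μ₂ : α → ℝ≥0∞) : ℝ≥0∞ :=
  ⨆ E : Set α, ((∑' x, E.indicator μ₁ x) - eexp ε * ∑' x, E.indicator μ₂ x)

/-- The `(ε, δ)`-lifting of a relation `Ψ` to distributions, with a sub-distribution on the product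
as witness. -/
def Lifting {α β : Type} (ε δ : ℝ≥0∞) (Ψ : α → β → Prop) (μ₁ : PMF α) (μ₂ : PMF β) : Prop :=
  ∃ μ : α × β → ℝ≥0∞, (∑' p, μ p) ≤ 1 ∧
    (∀ a b, 0 < μ (a, b) → Ψ a b) ∧
    (∀ a, (∑' b, μ (a, b)) ≤ μ₁ a) ∧ (∀ b, (∑' a, μ (a, b)) ≤ μ₂ b) ∧
    epsDist ε μ₁ (fun a => ∑' b, μ (a, b)) ≤ δ ∧ epsDist ε μ₂ (fun b => ∑' a, μ (a, b)) ≤ δ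

mutual

/-- Relational interpretation of relational types. -/
def RTy.den {Δ : List Ty} {A : Ty} (T : RTy Δ A) (θ : Env Δ) : A.den → A.den → Prop :=
  match T with
  | .core _ _ => fun _ _ => True
  | .M (A := A) ε δ T => fun (μ₁ μ₂ : PMF A.den) => Lifting (ε.den θ) (δ.den θ) (T.den θ) μ₁ μ₂
  | .pi (A := A) (B := B) T U => fun (f₁ f₂ : A.den → B.den) =>
      ∀ d₁ d₂, T.den θ d₁ d₂ → U.den (Env.cons d₁ (Env.cons d₂ θ)) (f₁ d₁) (f₂ d₂)
  | .ref T φ => fun d₁ d₂ => T.den θ d₁ d₂ ∧ φ.den (Env.cons d₁ (Env.cons d₂ θ))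

/-- Interpretation of assertions. -/
def Asrt.den {Δ : List Ty} (φ : Asrt Δ) (θ : Env Δ) : Prop :=
  match φ with
  | .allP A φ => ∀ d : A.den, φ.den (Env.cons d θ)
  | .exP A φ => ∃ d : A.den, φ.den (Env.cons d θ)
  | .allR (A := A) T φ => ∀ d₁ d₂ : A.den, T.den θ d₁ d₂ → φ.den (Env.cons d₁ (Env.cons d₂ θ))
  | .exR (A := A) T φ => ∃ d₁ d₂ : A.den, T.den θ d₁ d₂ ∧ φ.den (Env.cons d₁ (Env.cons d₂ θ))
  | .top => True
  | .bot => False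
  | .not φ => ¬ φ.den θ
  | .and φ ψ => φ.den θ ∧ ψ.den θ
  | .or φ ψ => φ.den θ ∨ ψ.den θ
  | .imp φ ψ => φ.den θ → ψ.den θ
  | .eq e₁ e₂ => e₁.den θ = e₂.den θ
  | .le N e₁ e₂ => N.le (e₁.den θ) (e₂.den θ)

end

/-- A simple type seen as a relational type without refinements (and with index `0,0` on `M`). -/
def Ty.rel {Δ : List Ty} : (A : Ty) → RTy Δ A
  | .unit => .core .unit trivial
  | .bool => .core .bool trivial
  | .nat => .core .nat trivial
  | .real => .core .real trivial
  | .ereal => .core .ereal trivial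
  | .list A => .core (.list A) trivial
  | .M A => .M (.prim (.ereal 0)) (.prim (.ereal 0)) A.rel
  | .fn A B => .pi A.rel B.rel

/-! ## Relational environments -/

/-- The context of the left and right instances of the variables of `Γ`. -/
def dbl : List Ty → List Ty
  | [] => []
  | A :: Γ => A :: A :: dbl Γ

/-- Left instance of a variable. -/
def Var.L : {Γ : List Ty} → (A : Ty) → Var Γ A → Var (dbl Γ) A
  | _, _, .z => .z
  | _, _, .s x => .s (.s (Var.L _ x))

/-- Right instance of a variable. -/
def Var.R : {Γ : List Ty} → (A : Ty) → Var Γ A → Var (dbl Γ) A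
  | _, _, .z => .s .z
  | _, _, .s x => .s (.s (Var.R _ x))

/-- The left instance `e◁` of an expression. -/
def Tm.L {Γ : List Ty} {A : Ty} (e : Tm Γ A) : Tm (dbl Γ) A := e.rename Var.L

/-- The right instance `e▷` of an expression. -/
def Tm.R {Γ : List Ty} {A : Ty} (e : Tm Γ A) : Tm (dbl Γ) A := e.rename Var.R

/-- Weakening by the two instances of a relational variable. -/
def Sub.wk₂ {Δ : List Ty} {A : Ty} : Sub Δ (A :: A :: Δ) := fun _ x => .var x.s.s

/-- Substitution of a pair of expressions for a relational variable. -/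
def Sub.inst₂ {Γ : List Ty} {A : Ty} (e₁ e₂ : Tm Γ A) : Sub (A :: A :: dbl Γ) (dbl Γ) :=
  Sub.cons e₁.L (Sub.cons e₂.R Sub.id)

def RTy.wk₂ {Δ : List Ty} {A B : Ty} (T : RTy Δ A) : RTy (B :: B :: Δ) A := T.subst Sub.wk₂

/-- Relational environments: relational bindings `x :: T` and assumptions `{φ}`. -/
inductive RCtx : List Ty → Type
  | nil : RCtx []
  | bind {Γ : List Ty} {A : Ty} (G : RCtx Γ) (T : RTy (dbl Γ) A) : RCtx (A :: Γ)
  | assume {Γ : List Ty} (G : RCtx Γ) (φ : Asrt (dbl Γ)) : RCtx Γ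

/-- The type of a variable in a relational environment. -/
def RCtx.lookup : {Γ : List Ty} → {A : Ty} → RCtx Γ → Var Γ A → RTy (dbl Γ) A
  | _, _, .bind _ T, .z => T.wk₂
  | _, _, .bind G _, .s x => (G.lookup x).wk₂
  | _, _, .assume G _, x => G.lookup x

/-- `θ ⊩ G`: the valuation `θ` validates the relational environment `G`. -/
def RCtx.Valid : {Γ : List Ty} → RCtx Γ → Env (dbl Γ) → Prop
  | _, .nil, _ => True
  | _, .bind (A := A) G T, θ =>
      G.Valid (Env.tail (Env.tail θ)) ∧ T.den (Env.tail (Env.tail θ)) (θ A .z) (θ A (.s .z))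
  | _, .assume G φ, θ => G.Valid θ ∧ φ.den θ

/-- Subtyping `G ⊢ T ≼ U`, complete with respect to the relational interpretation (semantic
subtyping). Both types have the same erasure. -/
def Subtype {Γ : List Ty} {A : Ty} (G : RCtx Γ) (T U : RTy (dbl Γ) A) : Prop :=
  ∀ θ : Env (dbl Γ), G.Valid θ → ∀ d₁ d₂ : A.den, T.den θ d₁ d₂ → U.den θ d₁ d₂

/-- In a context whose last relational variable is a natural number `k`: the type
`Π x :: {x :: T | m < b}. U`, for a bound `b` that may use `k`. -/
def sizedPi {Γ : List Ty} {A B : Ty} (T : RTy (dbl Γ) A) (U : RTy (A :: A :: dbl Γ) B)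
    (m : Tm (A :: A :: dbl Γ) .nat) (b : Tm (dbl (.nat :: Γ)) .nat) :
    RTy (dbl (.nat :: Γ)) (.fn A B) :=
  .pi (.ref T.wk₂
      (.not (.le .nat (b.subst Sub.wk₂) (m.subst (Sub.lift (Sub.lift Sub.wk₂))))))
    (U.subst (Sub.lift (Sub.lift Sub.wk₂)))

/-- The type `{k :: ℕ | k◁ = k▷}`. -/
def natEq {Δ : List Ty} : RTy Δ .nat := .ref (.core .nat trivial) (.eq (.var .z) (.var (.s .z)))

/-! ## Relational typing -/

/-- Relational typing `G ⊢ e₁ ∼ e₂ :: T`; the judgment `G ⊢ e :: T` is `G ⊢ e ∼ e :: T`.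

In `letrecSN` the termination guard is `SNGuard` together with sized typing: for some measure `m` of
the argument and every `k`, the body must be typed when `f` has its type on arguments of measure
`< k` only, and the argument has measure `< k + 1`. -/
inductive RTyping : {Γ : List Ty} → {A : Ty} → RCtx Γ → Tm Γ A → Tm Γ A → RTy (dbl Γ) A → Prop
  | var {Γ : List Ty} {A : Ty} (G : RCtx Γ) (x : Var Γ A) :
      RTyping G (.var x) (.var x) (G.lookup x)
  | prim {Γ : List Ty} {A : Ty} (G : RCtx Γ) (c : Prim A) :
      RTyping G (.prim c) (.prim c) A.rel
  | abs {Γ : List Ty} {A B : Ty} {G : RCtx Γ} {T : RTy (dbl Γ) A} {U : RTy (dbl (A :: Γ)) B}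
      {e : Tm (A :: Γ) B} :
      RTyping (G.bind T) e e U → RTyping G (.lam e) (.lam e) (.pi T U)
  | app {Γ : List Ty} {A B : Ty} {G : RCtx Γ} {T : RTy (dbl Γ) A} {U : RTy (A :: A :: dbl Γ) B}
      {e₁ : Tm Γ (.fn A B)} {e₂ : Tm Γ A} :
      RTyping G e₁ e₁ (.pi T U) → RTyping G e₂ e₂ T →
      RTyping G (.app e₁ e₂) (.app e₁ e₂) (U.subst (Sub.inst₂ e₂ e₂))
  | letE {Γ : List Ty} {A B : Ty} {G : RCtx Γ} {T : RTy (dbl Γ) A} {U : RTy (dbl (A :: Γ)) B}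
      {e₁ : Tm Γ A} {e₂ : Tm (A :: Γ) B} :
      RTyping G e₁ e₁ T → RTyping (G.bind T) e₂ e₂ U →
      RTyping G (.letE e₁ e₂) (.letE e₁ e₂) (U.subst (Sub.inst₂ e₁ e₁))
  | letrecSN {Γ : List Ty} {A B : Ty} {G : RCtx Γ} {T : RTy (dbl Γ) A}
      {U : RTy (A :: A :: dbl Γ) B} {e : Tm (A :: .fn A B :: Γ) B}
      (m : Tm (A :: A :: dbl Γ) .nat) :
      e.SNGuard →
      RTyping ((G.bind natEq).bind (sizedPi T U m (.var .z)))
        ((Tm.lam e).rename (Ren.lift Ren.wk)) ((Tm.lam e).rename (Ren.lift Ren.wk))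
        (sizedPi T U m (.app (.prim .succ) (.var .z))).wk₂ →
      RTyping G (.letrec e) (.letrec e) (.pi T U)
  | ite {Γ : List Ty} {A : Ty} {G : RCtx Γ} {T : RTy (dbl Γ) A} {e : Tm Γ .bool}
      {e₁ e₂ : Tm Γ A} :
      RTyping G e e (.core .bool trivial) →
      (∀ θ, G.Valid θ →
        (Asrt.iff (.eq e.L (.prim (.bool true))) (.eq e.R (.prim (.bool true)))).den θ) →
      RTyping (G.assume (.and (.eq e.L (.prim (.bool true))) (.eq e.R (.prim (.bool true)))))
        e₁ e₁ T →
      RTyping (G.assume (.and (.eq e.L (.prim (.bool false))) (.eq e.R (.prim (.bool false)))))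
        e₂ e₂ T →
      RTyping G (.ite e e₁ e₂) (.ite e e₁ e₂) T
  | case {Γ : List Ty} {A B : Ty} {G : RCtx Γ} {T : RTy (dbl Γ) B} {e : Tm Γ (.list A)}
      {e₁ : Tm Γ B} {e₂ : Tm (.list A :: A :: Γ) B} :
      RTyping G e e (.core (.list A) trivial) →
      (∀ θ, G.Valid θ → (Asrt.iff (.eq e.L (.prim (.nil A))) (.eq e.R (.prim (.nil A)))).den θ) →
      RTyping G e₁ e₁ T →
      RTyping (((G.bind A.rel).bind (.core (.list A) trivial)).assume
          (.and (.eq e.wk.wk.L (.cons (.var (.s (.s .z))) (.var .z)))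
            (.eq e.wk.wk.R (.cons (.var (.s (.s (.s .z)))) (.var (.s .z))))))
        e₂ e₂ T.wk₂.wk₂ →
      RTyping G (.case e e₁ e₂) (.case e e₁ e₂) T
  | unitM {Γ : List Ty} {A : Ty} {G : RCtx Γ} {T : RTy (dbl Γ) A} {e : Tm Γ A}
      (ε δ : Tm (dbl Γ) .ereal) :
      RTyping G e e T → RTyping G (.unitM e) (.unitM e) (.M ε δ T)
  | bindM {Γ : List Ty} {A B : Ty} {G : RCtx Γ} {T₁ : RTy (dbl Γ) A} {T₂ : RTy (dbl Γ) B}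
      {ε₁ δ₁ ε₂ δ₂ : Tm (dbl Γ) .ereal} {e₁ : Tm Γ (.M A)} {e₂ : Tm (A :: Γ) (.M B)} :
      RTyping G e₁ e₁ (.M ε₁ δ₁ T₁) →
      RTyping (G.bind T₁) e₂ e₂ (RTy.M ε₂ δ₂ T₂).wk₂ →
      RTyping G (.bindM e₁ e₂) (.bindM e₁ e₂) (.M (.add ε₁ ε₂) (.add δ₁ δ₂) T₂)
  | sub {Γ : List Ty} {A : Ty} {G : RCtx Γ} {T U : RTy (dbl Γ) A} {e₁ e₂ : Tm Γ A} :
      RTyping G e₁ e₂ T → Subtype G T U → RTyping G e₁ e₂ U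
  | aRedLeft {Γ : List Ty} {A : Ty} {G : RCtx Γ} {T : RTy (dbl Γ) A} {e₁ e₁' e₂ : Tm Γ A} :
      Red e₁ e₁' → RTyping G e₁ e₂ T → RTyping G e₁' e₂ T
  | aRedRight {Γ : List Ty} {A : Ty} {G : RCtx Γ} {T : RTy (dbl Γ) A} {e₁ e₂ e₂' : Tm Γ A} :
      Red e₂ e₂' → RTyping G e₁ e₂ T → RTyping G e₁ e₂' T
  | aCaseLeft {Γ : List Ty} {A B : Ty} {G : RCtx Γ} {T : RTy (dbl Γ) B} {e : Tm Γ (.list A)}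
      {e₁ e' : Tm Γ B} {e₂ : Tm (.list A :: A :: Γ) B} :
      e.SimplyTyped → e'.SimplyTyped →
      RTyping (G.assume (.eq e.L (.prim (.nil A)))) e₁ e' T →
      RTyping (((G.bind A.rel).bind (.core (.list A) trivial)).assume
          (.eq e.wk.wk.L (.cons (.var (.s (.s .z))) (.var .z))))
        e₂ e'.wk.wk T.wk₂.wk₂ →
      RTyping G (.case e e₁ e₂) e' T
  | aCaseRight {Γ : List Ty} {A B : Ty} {G : RCtx Γ} {T : RTy (dbl Γ) B} {e : Tm Γ (.list A)}
      {e₁ e' : Tm Γ B} {e₂ : Tm (.list A :: A :: Γ) B} :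
      e.SimplyTyped → e'.SimplyTyped →
      RTyping (G.assume (.eq e.R (.prim (.nil A)))) e' e₁ T →
      RTyping (((G.bind A.rel).bind (.core (.list A) trivial)).assume
          (.eq e.wk.wk.R (.cons (.var (.s (.s (.s .z)))) (.var (.s .z)))))
        e'.wk.wk e₂ T.wk₂.wk₂ →
      RTyping G e' (.case e e₁ e₂) T

/-! ## DFuzz expressions and typing -/

/-- DFuzz expressions over index variables `φ` and term variables `Γ`, annotated with the erasures
of their types (Church style). In `letrec e`, `x` is the last variable and `f` the one before; in
`letrecI e`, `f` is the last term variable and `i` the last index variable; in `case e e₁ e₂`, the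
branch `e₂` binds the index variable `i`, the head `x` and then the tail `xs`. -/
inductive DExp : List Kind → List Ty → Ty → Type
  | var {φ : List Kind} {Γ : List Ty} {A : Ty} (x : Var Γ A) : DExp φ Γ A
  | const {φ : List Kind} {Γ : List Ty} (r : ℝ≥0) : DExp φ Γ .real
  | lam {φ : List Kind} {Γ : List Ty} {A B : Ty} (e : DExp φ (A :: Γ) B) : DExp φ Γ (.fn A B)
  | app {φ : List Kind} {Γ : List Ty} {A B : Ty} (e₁ : DExp φ Γ (.fn A B)) (e₂ : DExp φ Γ A) :
      DExp φ Γ B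
  | letrec {φ : List Kind} {Γ : List Ty} {A B : Ty} (e : DExp φ (A :: .fn A B :: Γ) B) :
      DExp φ Γ (.fn A B)
  | letrecI {φ : List Kind} {Γ : List Ty} {A : Ty} (κ : Kind)
      (e : DExp (κ :: φ) (.fn κ.ty A :: Γ) A) : DExp φ Γ (.fn κ.ty A)
  | ilam {φ : List Kind} {Γ : List Ty} {A : Ty} (κ : Kind) (e : DExp (κ :: φ) Γ A) :
      DExp φ Γ (.fn κ.ty A)
  | iapp {φ : List Kind} {Γ : List Ty} {A : Ty} (κ : Kind) (e : DExp φ Γ (.fn κ.ty A))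
      (S : Idx φ κ) : DExp φ Γ A
  | ret {φ : List Kind} {Γ : List Ty} (e : DExp φ Γ .real) : DExp φ Γ (.M .real)
  | mlet {φ : List Kind} {Γ : List Ty} (e₁ : DExp φ Γ (.M .real))
      (e₂ : DExp φ (.real :: Γ) (.M .real)) : DExp φ Γ (.M .real)
  | nil {φ : List Kind} {Γ : List Ty} (A : Ty) : DExp φ Γ (.list A)
  | cons {φ : List Kind} {Γ : List Ty} {A : Ty} (e₁ : DExp φ Γ A) (e₂ : DExp φ Γ (.list A)) :
      DExp φ Γ (.list A)
  | case {φ : List Kind} {Γ : List Ty} {A B : Ty} (e : DExp φ Γ (.list A)) (e₁ : DExp φ Γ B)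
      (e₂ : DExp (.n :: φ) (.list A :: A :: Γ) B) : DExp φ Γ B

/-- Constraints `S₁ = S₂`. -/
def Constrs (φ : List Kind) : Type := List (Size φ × Size φ)

def Constrs.Sat {φ : List Kind} (Φ : Constrs φ) (ρ : IEnv φ) : Prop :=
  ∀ c ∈ (show List (Size φ × Size φ) from Φ), c.1.den ρ = c.2.den ρ

def Constrs.add {φ : List Kind} (Φ : Constrs φ) (S₁ S₂ : Size φ) : Constrs φ :=
  List.cons (S₁, S₂) Φ

def Constrs.wk {φ : List Kind} {κ : Kind} (Φ : Constrs φ) : Constrs (κ :: φ) :=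
  List.map (fun c => (c.1.subst ISub.wk, c.2.subst ISub.wk)) Φ

/-- Environments: finite maps sending a variable `x` in scope to `!_R σ`, or to `none` when `x` is
not in the domain of the environment. -/
def DCtx (φ : List Kind) (Γ : List Ty) : Type := (A : Ty) → Var Γ A → Option (Sens φ × DTy φ A)

def DCtx.empty {φ : List Kind} : DCtx φ [] := fun _ x => nomatch x

/-- `Δ, x :!_R σ`. -/
def DCtx.cons {φ : List Kind} {Γ : List Ty} {A : Ty} (R : Sens φ) (σ : DTy φ A) (Δ : DCtx φ Γ) :
    DCtx φ (A :: Γ)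
  | _, .z => some (R, σ)
  | _, .s x => Δ _ x

/-- `R · Δ`. -/
def DCtx.scale {φ : List Kind} {Γ : List Ty} (R : Sens φ) (Δ : DCtx φ Γ) : DCtx φ Γ :=
  fun A x => (Δ A x).map fun p => (.mul R p.1, p.2)

def DCtx.wk {φ : List Kind} {Γ : List Ty} {κ : Kind} (Δ : DCtx φ Γ) : DCtx (κ :: φ) Γ :=
  fun A x => (Δ A x).map fun p => (p.1.subst ISub.wk, p.2.subst ISub.wk)

inductive EntryAdd {φ : List Kind} {A : Ty} : Option (Sens φ × DTy φ A) →
    Option (Sens φ × DTy φ A) → Option (Sens φ × DTy φ A) → Prop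
  | both (R₁ R₂ : Sens φ) (σ : DTy φ A) : EntryAdd (some (R₁, σ)) (some (R₂, σ))
      (some (.add R₁ R₂, σ))
  | left (p : Sens φ × DTy φ A) : EntryAdd (some p) none (some p)
  | right (p : Sens φ × DTy φ A) : EntryAdd none (some p) (some p)
  | none : EntryAdd none none none

/-- `Δ = Δ₁ + Δ₂`. -/
def DCtx.IsAdd {φ : List Kind} {Γ : List Ty} (Δ₁ Δ₂ Δ : DCtx φ Γ) : Prop :=
  ∀ (A : Ty) (x : Var Γ A), EntryAdd (Δ₁ A x) (Δ₂ A x) (Δ A x)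

/-- Subtyping `φ; Φ ⊨ σ ⊑ τ`. -/
inductive DSub : {φ : List Kind} → {A : Ty} → Constrs φ → DTy φ A → DTy φ A → Prop
  | refl {φ : List Kind} {A : Ty} (Φ : Constrs φ) (σ : DTy φ A) : DSub Φ σ σ
  | trans {φ : List Kind} {A : Ty} {Φ : Constrs φ} {σ τ υ : DTy φ A} :
      DSub Φ σ τ → DSub Φ τ υ → DSub Φ σ υ
  | forget {φ : List Kind} (Φ : Constrs φ) (R : Sens φ) : DSub Φ (.realS R) .real
  | realS {φ : List Kind} {Φ : Constrs φ} {R R' : Sens φ} :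
      (∀ ρ, Φ.Sat ρ → R.den ρ = R'.den ρ) → DSub Φ (.realS R) (.realS R')
  | list {φ : List Kind} {A : Ty} {Φ : Constrs φ} {σ σ' : DTy φ A} {S S' : Size φ} :
      DSub Φ σ σ' → (∀ ρ, Φ.Sat ρ → S.den ρ = S'.den ρ) → DSub Φ (.list σ S) (.list σ' S')
  | lolli {φ : List Kind} {A B : Ty} {Φ : Constrs φ} {R R' : Sens φ} {σ σ' : DTy φ A}
      {τ τ' : DTy φ B} :
      (∀ ρ, Φ.Sat ρ → R.den ρ ≤ R'.den ρ) → DSub Φ σ' σ → DSub Φ τ τ' →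
      DSub Φ (.lolli R σ τ) (.lolli R' σ' τ')
  | all {φ : List Kind} {A : Ty} {Φ : Constrs φ} {κ : Kind} {σ σ' : DTy (κ :: φ) A} :
      DSub Φ.wk σ σ' → DSub Φ (.all κ σ) (.all κ σ')

inductive EntryLe {φ : List Kind} {A : Ty} (Φ : Constrs φ) :
    Option (Sens φ × DTy φ A) → Option (Sens φ × DTy φ A) → Prop
  | none (o : Option (Sens φ × DTy φ A)) : EntryLe Φ none o
  | some {R R' : Sens φ} {σ σ' : DTy φ A} :
      (∀ ρ, Φ.Sat ρ → R.den ρ ≤ R'.den ρ) → DSub Φ σ' σ → EntryLe Φ (some (R, σ)) (some (R', σ'))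

/-- The typing judgment `φ; Φ; Δ ⊢_D e : σ`.

The side condition of the two rules for recursion says that the iterates can start at all: the type
of `f` has an element at distance `0` from itself. (It can only fail because of types such as
`ℝ[∞]`.) Termination itself is not imposed here. -/
inductive DTyping : {φ : List Kind} → {Γ : List Ty} → {A : Ty} →
    Constrs φ → DCtx φ Γ → DExp φ Γ A → DTy φ A → Prop
  | var {φ : List Kind} {Γ : List Ty} {A : Ty} {Φ : Constrs φ} {Δ : DCtx φ Γ} {σ : DTy φ A}
      (x : Var Γ A) : Δ A x = some (.const 1, σ) → DTyping Φ Δ (.var x) σ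
  | const {φ : List Kind} {Γ : List Ty} (Φ : Constrs φ) (Δ : DCtx φ Γ) (r : ℝ≥0) :
      DTyping Φ Δ (.const r) (.realS (.const r))
  | lam {φ : List Kind} {Γ : List Ty} {A B : Ty} {Φ : Constrs φ} {Δ : DCtx φ Γ} {R : Sens φ}
      {σ : DTy φ A} {τ : DTy φ B} {e : DExp φ (A :: Γ) B} :
      DTyping Φ (Δ.cons R σ) e τ → DTyping Φ Δ (.lam e) (.lolli R σ τ)
  | app {φ : List Kind} {Γ : List Ty} {A B : Ty} {Φ : Constrs φ} {Δ₁ Δ₂ Δ : DCtx φ Γ}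
      {R : Sens φ} {σ : DTy φ A} {τ : DTy φ B} {e₁ : DExp φ Γ (.fn A B)} {e₂ : DExp φ Γ A} :
      DTyping Φ Δ₁ e₁ (.lolli R σ τ) → DTyping Φ Δ₂ e₂ σ → DCtx.IsAdd Δ₁ (Δ₂.scale R) Δ →
      DTyping Φ Δ (.app e₁ e₂) τ
  | letrec {φ : List Kind} {Γ : List Ty} {A B : Ty} {Φ : Constrs φ} {Δ : DCtx φ Γ} {R : Sens φ}
      {σ : DTy φ A} {τ : DTy φ B} {e : DExp φ (A :: .fn A B :: Γ) B} :
      (∀ ρ, Φ.Sat ρ → ∃ g, (DTy.lolli R σ τ).D ρ g g = 0) →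
      DTyping Φ ((Δ.cons .infty (.lolli R σ τ)).cons R σ) e τ →
      DTyping Φ (Δ.scale .infty) (.letrec e) (.lolli R σ τ)
  | letrecI {φ : List Kind} {Γ : List Ty} {A : Ty} {Φ : Constrs φ} {Δ : DCtx φ Γ} {κ : Kind}
      {σ : DTy (κ :: φ) A} {e : DExp (κ :: φ) (.fn κ.ty A :: Γ) A} :
      (∀ ρ, Φ.Sat ρ → ∃ g, (DTy.all κ σ).D ρ g g = 0) →
      DTyping Φ.wk (Δ.wk.cons .infty ((DTy.all κ σ).subst ISub.wk)) e σ →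
      DTyping Φ (Δ.scale .infty) (.letrecI κ e) (.all κ σ)
  | ilam {φ : List Kind} {Γ : List Ty} {A : Ty} {Φ : Constrs φ} {Δ : DCtx φ Γ} {κ : Kind}
      {σ : DTy (κ :: φ) A} {e : DExp (κ :: φ) Γ A} :
      DTyping Φ.wk Δ.wk e σ → DTyping Φ Δ (.ilam κ e) (.all κ σ)
  | iapp {φ : List Kind} {Γ : List Ty} {A : Ty} {Φ : Constrs φ} {Δ : DCtx φ Γ} {κ : Kind}
      {σ : DTy (κ :: φ) A} {e : DExp φ Γ (.fn κ.ty A)} (S : Idx φ κ) :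
      DTyping Φ Δ e (.all κ σ) → DTyping Φ Δ (.iapp κ e S) (σ.subst (ISub.inst S))
  | ret {φ : List Kind} {Γ : List Ty} {Φ : Constrs φ} {Δ : DCtx φ Γ} {e : DExp φ Γ .real} :
      DTyping Φ Δ e .real → DTyping Φ (Δ.scale .infty) (.ret e) .M
  | mlet {φ : List Kind} {Γ : List Ty} {Φ : Constrs φ} {Δ₁ Δ₂ Δ : DCtx φ Γ}
      {e₁ : DExp φ Γ (.M .real)} {e₂ : DExp φ (.real :: Γ) (.M .real)} :
      DTyping Φ Δ₁ e₁ .M → DTyping Φ (Δ₂.cons .infty .real) e₂ .M → DCtx.IsAdd Δ₁ Δ₂ Δ →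
      DTyping Φ Δ (.mlet e₁ e₂) .M
  | nil {φ : List Kind} {Γ : List Ty} {A : Ty} (Φ : Constrs φ) (Δ : DCtx φ Γ) (σ : DTy φ A) :
      DTyping Φ Δ (.nil A) (.list σ .zero)
  | cons {φ : List Kind} {Γ : List Ty} {A : Ty} {Φ : Constrs φ} {Δ₁ Δ₂ Δ : DCtx φ Γ}
      {σ : DTy φ A} {S : Size φ} {e₁ : DExp φ Γ A} {e₂ : DExp φ Γ (.list A)} :
      DTyping Φ Δ₁ e₁ σ → DTyping Φ Δ₂ e₂ (.list σ S) → DCtx.IsAdd Δ₁ Δ₂ Δ →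
      DTyping Φ Δ (.cons e₁ e₂) (.list σ (.succ S))
  | case {φ : List Kind} {Γ : List Ty} {A B : Ty} {Φ : Constrs φ} {Δ₁ Δ₂ Δ : DCtx φ Γ}
      {R : Sens φ} {σ : DTy φ A} {S : Size φ} {τ : DTy φ B} {e : DExp φ Γ (.list A)}
      {e₁ : DExp φ Γ B} {e₂ : DExp (.n :: φ) (.list A :: A :: Γ) B} :
      DTyping Φ Δ₂ e (.list σ S) →
      DTyping (Φ.add S .zero) Δ₁ e₁ τ →
      DTyping ((Φ.wk (κ := .n)).add (S.subst ISub.wk) (.succ (.var .z)))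
        ((Δ₁.wk.cons (R.subst ISub.wk) (σ.subst ISub.wk)).cons (R.subst ISub.wk)
          (.list (σ.subst ISub.wk) (.var .z)))
        e₂ (τ.subst ISub.wk) →
      DCtx.IsAdd Δ₁ (Δ₂.scale R) Δ →
      DTyping Φ Δ (.case e e₁ e₂) τ
  | sub {φ : List Kind} {Γ : List Ty} {A : Ty} {Φ : Constrs φ} {Δ Δ' : DCtx φ Γ}
      {σ σ' : DTy φ A} {e : DExp φ Γ A} :
      DTyping Φ Δ e σ → DSub Φ σ σ' → (∀ (B : Ty) (x : Var Γ B), EntryLe Φ (Δ B x) (Δ' B x)) →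
      DTyping Φ Δ' e σ'

/-! ## Translation of DFuzz into HOARe² -/

/-- The expressions that the translation puts for the index variables. -/
def IMap (φ : List Kind) (Δ : List Ty) : Type := (κ : Kind) → Var φ κ → Tm Δ κ.ty

def IMap.nil {Δ : List Ty} : IMap [] Δ := fun _ i => nomatch i

def IMap.wk {φ : List Kind} {Δ : List Ty} {B : Ty} (s : IMap φ Δ) : IMap φ (B :: Δ) :=
  fun κ i => (s κ i).wk

def IMap.cons {φ : List Kind} {Δ : List Ty} {κ : Kind} (e : Tm Δ κ.ty) (s : IMap φ Δ) :
    IMap (κ :: φ) Δ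
  | _, .z => e
  | _, .s i => s _ i

def Size.trans {φ : List Kind} {Δ : List Ty} (s : IMap φ Δ) : Size φ → Tm Δ .nat
  | .var i => s .n i
  | .zero => .prim (.nat 0)
  | .succ S => .app (.prim .succ) (S.trans s)

noncomputable def Sens.trans {φ : List Kind} {Δ : List Ty} (s : IMap φ Δ) : Sens φ → Tm Δ .ereal
  | .var i => s .r i
  | .size S => .app (.prim .natCast) (S.trans s)
  | .const r => .prim (.ereal r)
  | .infty => .prim (.ereal ⊤)
  | .add R₁ R₂ => .add (R₁.trans s) (R₂.trans s)
  | .mul R₁ R₂ => .app (.app (.prim .smul) (R₁.trans s)) (R₂.trans s)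

noncomputable def Idx.trans {φ : List Kind} {Δ : List Ty} (s : IMap φ Δ) :
    (κ : Kind) → Idx φ κ → Tm Δ κ.ty
  | .n, S => Size.trans s S
  | .r, R => Sens.trans s R

/-- Translation `σ*` of DFuzz types. In a refinement, `.var .z` is `x◁` and `.var (.s .z)` is `x▷`.
An index variable, whose two instances are required to be equal, is represented by the left one. -/
noncomputable def DTy.trans {φ : List Kind} {A : Ty} (σ : DTy φ A) {Δ : List Ty} (s : IMap φ Δ) :
    RTy Δ A :=
  match σ with
  | .real => .core .real trivial
  | .realS R => .ref (.core .real trivial)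
      (.and (.eq (.var .z) (.var (.s .z)))
        (.and (.le .real (.prim (.real 0)) (.var (.s .z)))
          (.eq (.app (.prim .ofReal) (.var (.s .z))) (R.trans s.wk.wk))))
  | .list (A := A) _ S => .ref (.core (.list A) trivial)
      (.and (.eq (.size (.var .z)) (.size (.var (.s .z))))
        (.eq (.size (.var (.s .z))) (S.trans s.wk.wk)))
  | .lolli _ σ τ => .pi (σ.trans s) (τ.trans s.wk.wk)
  | .all κ σ => .pi (.ref κ.ty.rel (.eq (.var .z) (.var (.s .z))))
      (σ.trans (IMap.cons (.var .z) s.wk.wk))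
  | .M => .M (.prim (.ereal 0)) (.prim (.ereal 0)) (.core .real trivial)

/-- Translation `e*` of DFuzz expressions, simultaneously replacing the index variables according to
`s` and the term variables according to `t`. In a `case`, the index variable bound in the second
branch is replaced by the length of the tail. -/
noncomputable def DExp.trans {φ : List Kind} {Γ : List Ty} {A : Ty} (e : DExp φ Γ A)
    {Δ : List Ty} (s : IMap φ Δ) (t : Sub Γ Δ) : Tm Δ A :=
  match e with
  | .var x => t _ x
  | .const r => .prim (.real r)
  | .lam e => .lam (e.trans s.wk t.lift)
  | .app e₁ e₂ => .app (e₁.trans s t) (e₂.trans s t)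
  | .letrec e => .letrec (e.trans s.wk.wk t.lift.lift)
  | .letrecI _ e => .letrec
      (e.trans (IMap.cons (.var .z) s.wk.wk) (Sub.cons (.var (.s .z)) fun _ x => (t _ x).wk.wk))
  | .ilam _ e => .lam (e.trans (IMap.cons (.var .z) s.wk) fun _ x => (t _ x).wk)
  | .iapp κ e S => .app (e.trans s t) (Idx.trans s κ S)
  | .ret e => .unitM (e.trans s t)
  | .mlet e₁ e₂ => .bindM (e₁.trans s t) (e₂.trans s.wk t.lift)
  | .nil A => .prim (.nil A)
  | .cons e₁ e₂ => .cons (e₁.trans s t) (e₂.trans s t)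
  | .case e e₁ e₂ => .case (e.trans s t) (e₁.trans s t)
      (e₂.trans (IMap.cons (κ := .n) (.size (.var .z)) s.wk.wk) t.lift.lift)

/-- `e*`, for an expression without free index variables. -/
noncomputable def DExp.star {Γ : List Ty} {A : Ty} (e : DExp [] Γ A) : Tm Γ A :=
  e.trans IMap.nil Sub.id

/-- `σ*`, for a closed type. -/
noncomputable def DTy.star {Δ : List Ty} {A : Ty} (σ : DTy [] A) : RTy Δ A := σ.trans IMap.nil

/-- `R*`, for a closed sensitivity. -/
noncomputable def Sens.star {Δ : List Ty} (R : Sens []) : Tm Δ .ereal := R.trans IMap.nil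

/-- The distance of a closed DFuzz type. -/
noncomputable def DTy.dist {A : Ty} (σ : DTy [] A) : A.den → A.den → ℝ≥0∞ := σ.D IEnv.nil

/-- The relational type `{x :: τ* | D_τ(x◁, x▷) ≤ 1}`. -/
noncomputable def adjacentTy {Δ : List Ty} {A : Ty} (τ : DTy [] A) : RTy Δ A :=
  .ref τ.star
    (.le .ereal (.dist τ IMap.nil (.var .z) (.var (.s .z))) (.prim (.ereal 1)))

/-- The relational type `M_{ε,0}[{y :: ℝ | y◁ = y▷}]`. -/
noncomputable def privateTy {Δ : List Ty} (ε : Sens []) : RTy Δ (.M .real) :=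
  .M ε.star (.prim (.ereal 0)) (.ref (.core .real trivial) (.eq (.var .z) (.var (.s .z))))

/-- `(ε, δ)`-differential privacy of a randomized function with respect to an adjacency relation. -/
def DifferentiallyPrivate {α β : Type} (adj : α → α → Prop) (ε δ : ℝ≥0) (F : α → PMF β) : Prop :=
  ∀ t₁ t₂, adj t₁ t₂ → ∀ E : Set β,
    (F t₁).toOuterMeasure E ≤ ENNReal.ofReal (Real.exp ε) * (F t₂).toOuterMeasure E + δ

end HOARe

/-!
Both claims rest on metric preservation (`DTyping.D_le_cost`): if `Δ ⊢ e : σ`, then the values of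
`e*` in two valuations which agree on the index variables are at `D_σ`-distance at most
`∑ R ⋄ D(x₁, x₂)`, summed over the bindings `x :!_R` of `Δ`. This is an induction on the DFuzz
derivation. The conventions for `⋄` at `∞` are what makes `R ⋄ (R' ⋄ d) ≤ (R ⋄ R') ⋄ d` and both
distributive laws hold. In a recursive definition the environment is scaled by `∞`, so that its
distance is `∞`, where nothing has to be shown, or `0`. In the second case the two functionals map
functions at distance `0` to functions at distance `0`; iterating them from an element at distance
`0` from itself yields such pairs of functions throughout, and balls are closed under the
convergence demanded by the termination guard (`DTy.D_le_of_conv`). Monadic sequencing is the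
composition theorem of pure differential privacy, read pointwise.

On inputs at distance at most `1` the output distributions are hence at distance at most `ε`, which
means that their densities differ by a factor of at most `exp ε`. Summation gives differential
privacy, and the pointwise minimum of the two densities, placed on the diagonal, is a witness for
the `(ε, 0)`-lifting of equality. The relational judgment is thus valid in all valuations.

It is derivable because relational typing with semantic subtyping is complete for simply typed
expressions (`Tm.SimplyTyped.rtyping_of_valid`). A hypothesis `φ` is discharged by abstracting over
a unit variable refined by `φ`, applying the abstraction to `()` and reducing. With a false
hypothesis the synchronization conditions hold vacuously, and since `Π (u :: {unit | ⊥}). A` is a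
subtype of `Π (u :: unit). A`, every `e` gets its unrefined type `A`. The identity has the type
`Π (y :: {y | y = e}). {z | z = e}`, a subtype of `Π (y :: A). {z | y = e → z = e}`; applying it to
`e` and reducing gives `e` the type `{z | z◁ = e◁ ∧ z▷ = e▷}`, which is a subtype of every type that
is valid for `e`.
-/

namespace HOARe

/-! ### Renaming and substitution -/

theorem Ren.lift_comp {Γ Δ Ξ : List Ty} {B : Ty} (r : Ren Γ Δ) (r' : Ren Δ Ξ) :
    (fun A x => (Ren.lift r' : Ren (B :: Δ) (B :: Ξ)) A ((Ren.lift r : Ren (B :: Γ) _) A x)) =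
      Ren.lift (B := B) (fun A x => r' A (r A x)) := by
  funext A x
  cases x <;> rfl

theorem Tm.rename_rename {Γ : List Ty} {A : Ty} (e : Tm Γ A) : ∀ {Δ Ξ : List Ty} (r : Ren Γ Δ)
    (r' : Ren Δ Ξ), (e.rename r).rename r' = e.rename (fun A x => r' A (r A x)) := by
  induction e <;> intro Δ Ξ r r' <;> simp_all [Tm.rename, Ren.lift_comp]

theorem Sub.lift_rename {Γ Δ Ξ : List Ty} {B : Ty} (r : Ren Γ Δ) (s : Sub Δ Ξ) :
    (fun A x => (Sub.lift s : Sub (B :: Δ) (B :: Ξ)) A ((Ren.lift r : Ren (B :: Γ) _) A x)) =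
      Sub.lift (B := B) (fun A x => s A (r A x)) := by
  funext A x
  cases x <;> rfl

theorem Tm.subst_rename {Γ : List Ty} {A : Ty} (e : Tm Γ A) : ∀ {Δ Ξ : List Ty} (r : Ren Γ Δ)
    (s : Sub Δ Ξ), (e.rename r).subst s = e.subst (fun A x => s A (r A x)) := by
  induction e <;> intro Δ Ξ r s <;> simp_all [Tm.rename, Tm.subst, Sub.lift_rename]

theorem Sub.lift_id {Γ : List Ty} {B : Ty} : Sub.lift (B := B) (Sub.id : Sub Γ Γ) = Sub.id := by
  funext A x
  cases x <;> rfl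

theorem Tm.subst_id {Γ : List Ty} {A : Ty} (e : Tm Γ A) : e.subst Sub.id = e := by
  induction e <;> simp_all [Tm.subst, Sub.lift_id]
  rfl

theorem Tm.wk_subst_cons {Γ : List Ty} {A B : Ty} (e : Tm Γ A) (a : Tm Γ B) :
    e.wk.subst (Sub.cons a Sub.id) = e := by
  rw [Tm.wk, Tm.subst_rename]
  exact e.subst_id

/-- The valuation `θ ∘ r`. -/
def Ren.env {Γ Δ : List Ty} (r : Ren Γ Δ) (θ : Env Δ) : Env Γ := fun A x => θ A (r A x)

/-- The valuation giving to every variable the value of the expression substituted for it. -/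
noncomputable def Sub.env {Γ Δ : List Ty} (s : Sub Γ Δ) (θ : Env Δ) : Env Γ :=
  fun A x => (s A x).den θ

theorem Ren.env_lift {Γ Δ : List Ty} {B : Ty} (r : Ren Γ Δ) (d : B.den) (θ : Env Δ) :
    (Ren.lift r).env (Env.cons d θ) = Env.cons d (r.env θ) := by
  funext A x
  cases x <;> rfl

theorem Ren.env_lift_lift {Γ Δ : List Ty} {B C : Ty} (r : Ren Γ Δ) (c : C.den) (b : B.den)
    (θ : Env Δ) :
    (Ren.lift (Ren.lift r)).env (Env.cons c (Env.cons b θ)) =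
      Env.cons c (Env.cons b (r.env θ)) := by
  rw [Ren.env_lift, Ren.env_lift]

theorem Tm.den_rename {Γ : List Ty} {A : Ty} (e : Tm Γ A) : ∀ {Δ : List Ty} (r : Ren Γ Δ)
    (θ : Env Δ), (e.rename r).den θ = e.den (r.env θ) := by
  induction e with
  | letrec e ih =>
    intro Δ r θ
    exact congrArg (fun F => Classical.epsilon (IsRec _ _ F)) (funext fun g => funext fun d =>
      (ih _ _).trans (congrArg e.den (Ren.env_lift_lift r (B := .fn _ _) d g θ)))
  | case e e₁ e₂ ih ih₁ ih₂ =>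
    intro Δ r θ
    simp only [Tm.rename, Tm.den, ih, ih₁, ih₂]
    cases (e.den (r.env θ) : List _) with
    | nil => rfl
    | cons a l => exact congrArg e₂.den (Ren.env_lift_lift r (C := .list _) l a θ)
  | dist σ t e₁ e₂ iht ih₁ ih₂ =>
    intro Δ r θ
    simp only [Tm.rename, Tm.den, ih₁, ih₂, iht]
    rfl
  | _ => intro Δ r θ; simp_all only [Tm.rename, Tm.den, Ren.env_lift] <;> rfl

theorem Tm.den_wk {Γ : List Ty} {A B : Ty} (e : Tm Γ A) (d : B.den) (θ : Env Γ) :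
    e.wk.den (Env.cons d θ) = e.den θ :=
  e.den_rename _ _

theorem Sub.env_lift {Γ Δ : List Ty} {B : Ty} (s : Sub Γ Δ) (d : B.den) (θ : Env Δ) :
    (Sub.lift s).env (Env.cons d θ) = Env.cons d (s.env θ) := by
  funext A x
  cases x with
  | z => rfl
  | s x => exact Tm.den_wk _ _ _

theorem Sub.env_lift_lift {Γ Δ : List Ty} {B C : Ty} (s : Sub Γ Δ) (c : C.den) (b : B.den)
    (θ : Env Δ) :
    (Sub.lift (Sub.lift s)).env (Env.cons c (Env.cons b θ)) =
      Env.cons c (Env.cons b (s.env θ)) := by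
  rw [Sub.env_lift, Sub.env_lift]

theorem Tm.den_subst {Γ : List Ty} {A : Ty} (e : Tm Γ A) : ∀ {Δ : List Ty} (s : Sub Γ Δ)
    (θ : Env Δ), (e.subst s).den θ = e.den (s.env θ) := by
  induction e with
  | letrec e ih =>
    intro Δ s θ
    exact congrArg (fun F => Classical.epsilon (IsRec _ _ F)) (funext fun g => funext fun d =>
      (ih _ _).trans (congrArg e.den (Sub.env_lift_lift s (B := .fn _ _) d g θ)))
  | case e e₁ e₂ ih ih₁ ih₂ =>
    intro Δ s θ
    simp only [Tm.subst, Tm.den, ih, ih₁, ih₂]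
    cases (e.den (s.env θ) : List _) with
    | nil => rfl
    | cons a l => exact congrArg e₂.den (Sub.env_lift_lift s (C := .list _) l a θ)
  | dist σ t e₁ e₂ iht ih₁ ih₂ =>
    intro Δ s θ
    simp only [Tm.subst, Tm.den, ih₁, ih₂, iht]
    rfl
  | _ => intro Δ s θ; simp_all only [Tm.subst, Tm.den, Sub.env_lift] <;> rfl

theorem Tm.SNGuard.rename {Γ Δ : List Ty} {A B : Ty} {e : Tm (A :: .fn A B :: Γ) B}
    (h : e.SNGuard) (r : Ren Γ Δ) : (e.rename r.lift.lift).SNGuard := by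
  intro θ
  obtain ⟨f, hf⟩ := h (r.env θ)
  refine ⟨f, ?_⟩
  convert hf using 3 with g d
  exact (Tm.den_rename _ _ _).trans (congrArg e.den (Ren.env_lift_lift r (B := .fn A B) d g θ))

theorem Tm.SimplyTyped.rename {Γ : List Ty} {A : Ty} {e : Tm Γ A} (h : e.SimplyTyped) :
    ∀ {Δ : List Ty} (r : Ren Γ Δ), (e.rename r).SimplyTyped := by
  induction e with
  | letrec e ih => exact fun r => ⟨ih h.1 _, h.2.rename r⟩
  | _ => intro Δ r; simp_all [Tm.rename, Tm.SimplyTyped]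

/-! ### Totality of unrefined relational types -/

theorem one_le_eexp (ε : ℝ≥0∞) : 1 ≤ eexp ε := by
  unfold eexp
  split_ifs
  · exact le_top
  · exact ENNReal.one_le_ofReal.2 (Real.one_le_exp ENNReal.toReal_nonneg)

theorem epsDist_eq_zero {α : Type} {ε : ℝ≥0∞} {μ₁ μ₂ : α → ℝ≥0∞}
    (h : ∀ x, μ₁ x ≤ eexp ε * μ₂ x) : epsDist ε μ₁ μ₂ = 0 := by
  refine le_antisymm (iSup_le fun E => tsub_le_iff_right.2 ?_) bot_le
  rw [zero_add, ← ENNReal.tsum_mul_left]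
  refine ENNReal.tsum_le_tsum fun x => ?_
  by_cases hx : x ∈ E <;> simp [hx, h]

/-- The product coupling shows that a total relation lifts to a total relation. -/
theorem Lifting.of_forall {α β : Type} {ε δ : ℝ≥0∞} {Ψ : α → β → Prop} (h : ∀ a b, Ψ a b)
    (μ₁ : PMF α) (μ₂ : PMF β) : Lifting ε δ Ψ μ₁ μ₂ := by
  have h₁ : ∀ a, ∑' b, μ₁ a * μ₂ b = μ₁ a := fun a => by
    rw [ENNReal.tsum_mul_left, μ₂.tsum_coe, mul_one]
  have h₂ : ∀ b, ∑' a, μ₁ a * μ₂ b = μ₂ b := fun b => by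
    rw [ENNReal.tsum_mul_right, μ₁.tsum_coe, one_mul]
  refine ⟨fun p => μ₁ p.1 * μ₂ p.2, ?_, fun a b _ => h a b, fun a => (h₁ a).le,
    fun b => (h₂ b).le, ?_, ?_⟩
  · rw [ENNReal.tsum_prod (f := fun a b => μ₁ a * μ₂ b)]
    simp only [h₁, μ₁.tsum_coe, le_refl]
  · rw [epsDist_eq_zero]
    · exact bot_le
    · intro a
      simp only [h₁]
      exact le_mul_of_one_le_left' (one_le_eexp ε)
  · rw [epsDist_eq_zero]
    · exact bot_le
    · intro b
      simp only [h₂]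
      exact le_mul_of_one_le_left' (one_le_eexp ε)

theorem Ty.rel_den (A : Ty) : ∀ {Δ : List Ty} (θ : Env Δ) (d₁ d₂ : A.den),
    (A.rel : RTy Δ A).den θ d₁ d₂ := by
  induction A with
  | M A ih => exact fun θ _ _ => Lifting.of_forall (ih θ) _ _
  | fn A B _ ih => exact fun θ _ _ _ _ _ => ih _ _ _
  | _ => exact fun _ _ _ => trivial

theorem Ty.rel_subst (A : Ty) : ∀ {Δ Δ' : List Ty} (s : Sub Δ Δ'),
    (A.rel : RTy Δ A).subst s = A.rel := by
  induction A with
  | M A ih => intro Δ Δ' s; simp only [Ty.rel, RTy.subst, ih, Tm.subst]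
  | fn A B ihA ihB => intro Δ Δ' s; simp only [Ty.rel, RTy.subst, ihA, ihB]
  | _ => exact fun _ => rfl

/-! ### Completeness of relational typing for semantic validity -/

/-- No valuation validates the relational environment. -/
def RCtx.Inconsistent {Γ : List Ty} (G : RCtx Γ) : Prop := ∀ θ, ¬ G.Valid θ

theorem RCtx.Inconsistent.bind {Γ : List Ty} {A : Ty} {G : RCtx Γ} (h : G.Inconsistent)
    (T : RTy (dbl Γ) A) : (G.bind T).Inconsistent :=
  fun _ hθ => h _ hθ.1

theorem RCtx.Inconsistent.assume {Γ : List Ty} {G : RCtx Γ} (h : G.Inconsistent)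
    (φ : Asrt (dbl Γ)) : (G.assume φ).Inconsistent :=
  fun _ hθ => h _ hθ.1

theorem RCtx.Inconsistent.subtype {Γ : List Ty} {A : Ty} {G : RCtx Γ} (h : G.Inconsistent)
    (T U : RTy (dbl Γ) A) : Subtype G T U :=
  fun θ hθ => (h θ hθ).elim

/-- In an inconsistent environment the synchronization conditions of the rules for `ite` and `case`
hold vacuously, so that relational typing reduces to simple typing. Renamings are needed
because the rule for recursion weakens the body by the size variable. -/
theorem Tm.SimplyTyped.rtyping_rename {Γ : List Ty} {A : Ty} {e : Tm Γ A} (he : e.SimplyTyped) :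
    ∀ {Δ : List Ty} (r : Ren Γ Δ) {G : RCtx Δ}, G.Inconsistent →
      ∀ T : RTy (dbl Δ) A, RTyping G (e.rename r) (e.rename r) T := by
  induction e with
  | var x => exact fun r G hG T => .sub (.var G (r _ x)) (hG.subtype _ _)
  | prim c => exact fun r G hG T => .sub (.prim G c) (hG.subtype _ _)
  | app e₁ e₂ ih₁ ih₂ =>
    exact fun r G hG T => .sub (.app (T := Ty.rel _) (U := Ty.rel _) (ih₁ he.1 r hG _)
      (ih₂ he.2 r hG _)) (hG.subtype _ _)
  | lam e ih =>
    exact fun r G hG T => .sub (.abs (T := Ty.rel _) (U := Ty.rel _)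
      (ih he _ (hG.bind _) _)) (hG.subtype _ _)
  | letE e₁ e₂ ih₁ ih₂ =>
    exact fun r G hG T => .sub (.letE (T := Ty.rel _) (U := Ty.rel _) (ih₁ he.1 r hG _)
      (ih₂ he.2 _ (hG.bind _) _)) (hG.subtype _ _)
  | letrec e ih =>
    rename_i A B
    intro Δ r G hG T
    -- The constant measure `0` will do: the environment of the body is inconsistent as well.
    refine .sub (.letrecSN (T := A.rel) (U := B.rel) (.prim (.nat 0)) (he.2.rename r) ?_)
      (hG.subtype _ _)
    have hG' := (hG.bind natEq).bind (sizedPi A.rel B.rel (.prim (.nat 0)) (.var .z))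
    refine .sub (T := .pi A.rel B.rel) ?_ (hG'.subtype _ _)
    simp only [Tm.rename, Tm.rename_rename]
    exact .abs (ih he.1 _ (hG'.bind _) _)
  | ite e e₁ e₂ ih ih₁ ih₂ =>
    exact fun r G hG T => .ite (ih he.1 r hG _) (fun θ hθ => (hG θ hθ).elim)
      (ih₁ he.2.1 r (hG.assume _) _) (ih₂ he.2.2 r (hG.assume _) _)
  | case e e₁ e₂ ih ih₁ ih₂ =>
    exact fun r G hG T => .case (ih he.1 r hG _) (fun θ hθ => (hG θ hθ).elim)
      (ih₁ he.2.1 r hG _) (ih₂ he.2.2 _ (((hG.bind _).bind _).assume _) _)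
  | unitM e ih =>
    exact fun r G hG T => .sub (.unitM (T := Ty.rel _) (.prim (.ereal 0)) (.prim (.ereal 0))
      (ih he r hG _)) (hG.subtype _ _)
  | bindM e₁ e₂ ih₁ ih₂ =>
    exact fun r G hG T => .sub (.bindM (T₁ := Ty.rel _) (T₂ := Ty.rel _)
      (ε₁ := .prim (.ereal 0)) (δ₁ := .prim (.ereal 0)) (ε₂ := .prim (.ereal 0))
      (δ₂ := .prim (.ereal 0)) (ih₁ he.1 r hG _) (ih₂ he.2 _ (hG.bind _) _)) (hG.subtype _ _)
  | dist => exact he.elim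

/-- The valuation of the left instances. -/
def Env.left {Γ : List Ty} (θ : Env (dbl Γ)) : Env Γ := Ren.env Var.L θ

/-- The valuation of the right instances. -/
def Env.right {Γ : List Ty} (θ : Env (dbl Γ)) : Env Γ := Ren.env Var.R θ

theorem Tm.den_L {Γ : List Ty} {A : Ty} (e : Tm Γ A) (θ : Env (dbl Γ)) :
    e.L.den θ = e.den θ.left := e.den_rename _ _

theorem Tm.den_R {Γ : List Ty} {A : Ty} (e : Tm Γ A) (θ : Env (dbl Γ)) :
    e.R.den θ = e.den θ.right := e.den_rename _ _

/-- A hypothesis is discharged by abstracting over a unit variable refined by it: as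
`Π (u :: {unit | ⊥}). A ≼ Π (u :: unit). A`, the redex `(λ u. e) ()`, and hence its reduct `e`,
inherits a typing that was obtained under a contradictory hypothesis. -/
theorem Tm.SimplyTyped.rtyping_rel {Γ : List Ty} {A : Ty} {e : Tm Γ A} (he : e.SimplyTyped)
    (G : RCtx Γ) : RTyping G e e A.rel := by
  have hG : (G.bind (.ref (.core .unit trivial) .bot)).Inconsistent := fun θ hθ => hθ.2.2
  have h₁ : RTyping G (.lam e.wk) (.lam e.wk) (.pi (.core .unit trivial) A.rel) :=
    .sub (.abs (he.rtyping_rename Ren.wk hG A.rel))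
      (fun θ _ f₁ f₂ _ d₁ d₂ _ => A.rel_den _ _ _)
  have h₂ := RTyping.app h₁ (.prim G .unit)
  rw [Ty.rel_subst] at h₂
  have h₃ := RTyping.aRedRight (.beta _ _) (.aRedLeft (.beta _ _) h₂)
  rwa [Tm.wk_subst_cons] at h₃

theorem Tm.den_wk_wk {Δ : List Ty} {A B C : Ty} (e : Tm Δ A) (θ : Env (C :: B :: Δ)) :
    e.wk.wk.den θ = e.den θ.tail.tail :=
  (Tm.den_rename _ _ _).trans (Tm.den_rename _ _ _)

/-- The type `{z :: A | z◁ = a ∧ z▷ = b}`. -/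
def pairTy {Δ : List Ty} {A : Ty} (a b : Tm Δ A) : RTy Δ A :=
  .ref A.rel (.and (.eq (.var .z) a.wk.wk) (.eq (.var (.s .z)) b.wk.wk))

theorem pairTy_den {Δ : List Ty} {A : Ty} (a b : Tm Δ A) (θ : Env Δ) (d₁ d₂ : A.den) :
    (pairTy a b).den θ d₁ d₂ ↔ d₁ = a.den θ ∧ d₂ = b.den θ := by
  refine (and_iff_right (A.rel_den θ d₁ d₂)).trans ?_
  exact and_congr (Eq.congr_right ((Tm.den_wk _ _ _).trans (Tm.den_wk _ _ _)))
    (Eq.congr_right ((Tm.den_wk _ _ _).trans (Tm.den_wk _ _ _)))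

theorem pairTy_subst_den {Δ Δ' : List Ty} {A : Ty} (s : Sub Δ Δ') (a b : Tm Δ A) (θ : Env Δ')
    (d₁ d₂ : A.den) :
    ((pairTy a b).subst s).den θ d₁ d₂ ↔ d₁ = a.den (s.env θ) ∧ d₂ = b.den (s.env θ) := by
  have h : ∀ e : Tm Δ A, (((e.wk (B := A)).wk (B := A)).subst s.lift.lift).den
      (Env.cons d₁ (Env.cons d₂ θ)) = e.den (s.env θ) := fun e => by
    rw [Tm.den_subst, Sub.env_lift_lift, Tm.den_wk, Tm.den_wk]
  unfold pairTy
  simp only [RTy.subst, Ty.rel_subst]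
  exact (and_iff_right (A.rel_den θ d₁ d₂)).trans
    (and_congr (Eq.congr_right (h a)) (Eq.congr_right (h b)))

/-- In the scope of `y`, the type `{z :: A | (y◁ = a ∧ y▷ = b) → (z◁ = a ∧ z▷ = b)}`. -/
def condPairTy {Δ : List Ty} {A : Ty} (a b : Tm Δ A) : RTy (A :: A :: Δ) A :=
  .ref A.rel (.imp
    (.and (.eq (.var (.s (.s .z))) a.wk.wk.wk.wk) (.eq (.var (.s (.s (.s .z)))) b.wk.wk.wk.wk))
    (.and (.eq (.var .z) a.wk.wk.wk.wk) (.eq (.var (.s .z)) b.wk.wk.wk.wk)))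

theorem condPairTy_den {Δ : List Ty} {A : Ty} (a b : Tm Δ A) (θ : Env Δ) (y₁ y₂ d₁ d₂ : A.den) :
    (condPairTy a b).den (Env.cons y₁ (Env.cons y₂ θ)) d₁ d₂ ↔
      (y₁ = a.den θ ∧ y₂ = b.den θ → d₁ = a.den θ ∧ d₂ = b.den θ) := by
  have h : ∀ e : Tm Δ A, ((((e.wk (B := A)).wk (B := A)).wk (B := A)).wk (B := A)).den
      (Env.cons d₁ (Env.cons d₂ (Env.cons y₁ (Env.cons y₂ θ)))) = e.den θ := fun e => by
    simp only [Tm.den_wk]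
  exact (and_iff_right (A.rel_den _ d₁ d₂)).trans
    (imp_congr (and_congr (Eq.congr_right (h a)) (Eq.congr_right (h b)))
      (and_congr (Eq.congr_right (h a)) (Eq.congr_right (h b))))

theorem condPairTy_subst_den {Δ : List Ty} {A : Ty} (a b : Tm Δ A) (θ : Env Δ) (d₁ d₂ : A.den)
    (h : ((condPairTy a b).subst (Sub.cons a (Sub.cons b Sub.id))).den θ d₁ d₂) :
    d₁ = a.den θ ∧ d₂ = b.den θ := by
  have hs : (Sub.cons a (Sub.cons b Sub.id)).env θ = Env.cons (a.den θ) (Env.cons (b.den θ) θ) := by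
    funext B x
    rcases x with _ | _ | x <;> rfl
  have hw : ∀ e : Tm Δ A, (((((e.wk (B := A)).wk (B := A)).wk (B := A)).wk (B := A)).subst
      (Sub.cons a (Sub.cons b Sub.id)).lift.lift).den (Env.cons d₁ (Env.cons d₂ θ)) =
      e.den θ := fun e => by
    rw [Tm.den_subst, Sub.env_lift_lift, hs]
    simp only [Tm.den_wk]
  obtain ⟨h₁, h₂⟩ := h.2 ⟨((Tm.den_wk _ _ _).trans (Tm.den_wk _ _ _)).trans (hw a).symm,
    ((Tm.den_wk _ _ _).trans (Tm.den_wk _ _ _)).trans (hw b).symm⟩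
  exact ⟨h₁.trans (hw a), h₂.trans (hw b)⟩

/-- Every expression has its most precise type. The identity maps `{y | y = e}` to `{z | z = e}`,
hence it has type `Π (y :: A). {z | y = e → z = e}` by semantic subtyping; instantiating `y` with
`e` makes the premise true, and `(λ y. y) e` reduces to `e`. -/
theorem Tm.SimplyTyped.rtyping_exact {Γ : List Ty} {A : Ty} {e : Tm Γ A} (he : e.SimplyTyped)
    (G : RCtx Γ) : RTyping G e e (pairTy e.L e.R) := by
  have h₁ : RTyping G (.lam (.var .z)) (.lam (.var .z))
      (.pi (pairTy e.L e.R) (pairTy e.L.wk.wk e.R.wk.wk)) := by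
    refine .abs (.sub (.var _ .z) fun θ _ d₁ d₂ hd => (pairTy_den _ _ _ _ _).2 ?_)
    have := (pairTy_subst_den _ _ _ _ _ _).1 hd
    exact ⟨this.1.trans (Tm.den_wk_wk _ _).symm, this.2.trans (Tm.den_wk_wk _ _).symm⟩
  have h₂ : RTyping G (.lam (.var .z)) (.lam (.var .z)) (.pi A.rel (condPairTy e.L e.R)) := by
    refine .sub h₁ fun θ _ f₁ f₂ hf y₁ y₂ _ => (condPairTy_den _ _ _ _ _ _ _).2 fun hy => ?_
    have := (pairTy_den _ _ _ _ _).1 (hf y₁ y₂ ((pairTy_den _ _ _ _ _).2 hy))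
    rwa [Tm.den_wk, Tm.den_wk, Tm.den_wk, Tm.den_wk] at this
  have h₃ := RTyping.app h₂ (he.rtyping_rel G)
  have h₄ : RTyping G e e _ := RTyping.aRedRight (.beta _ _) (.aRedLeft (.beta _ _) h₃)
  exact .sub h₄ fun θ _ d₁ d₂ hd => (pairTy_den _ _ _ _ _).2 (condPairTy_subst_den _ _ θ d₁ d₂ hd)

/-- Completeness of relational typing: a judgment about a simply typed expression which holds in
all valuations is derivable. -/
theorem Tm.SimplyTyped.rtyping_of_valid {Γ : List Ty} {A : Ty} {e : Tm Γ A} (he : e.SimplyTyped)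
    {G : RCtx Γ} {T : RTy (dbl Γ) A}
    (h : ∀ θ, G.Valid θ → T.den θ (e.den θ.left) (e.den θ.right)) : RTyping G e e T := by
  refine .sub (he.rtyping_exact G) fun θ hθ d₁ d₂ hd => ?_
  obtain ⟨rfl, rfl⟩ := (pairTy_den _ _ _ _ _).1 hd
  rw [Tm.den_L, Tm.den_R]
  exact h θ hθ

/-! ### Arithmetic of sensitivities and distances -/

theorem dmul_top (s : ℝ≥0∞) : dmul s ⊤ = ⊤ := if_pos rfl

theorem dmul_of_ne_top (s : ℝ≥0∞) {d : ℝ≥0∞} (h : d ≠ ⊤) : dmul s d = s * d := if_neg h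

theorem dmul_zero (s : ℝ≥0∞) : dmul s 0 = 0 := by
  rw [dmul_of_ne_top _ ENNReal.zero_ne_top, mul_zero]

theorem dmul_one_left (d : ℝ≥0∞) : dmul 1 d = d := by
  rcases eq_or_ne d ⊤ with rfl | hd
  · exact dmul_top _
  · rw [dmul_of_ne_top _ hd, one_mul]

theorem dmul_mono {s s' d d' : ℝ≥0∞} (hs : s ≤ s') (hd : d ≤ d') : dmul s d ≤ dmul s' d' := by
  rcases eq_or_ne d' ⊤ with rfl | hd'
  · rw [dmul_top]
    exact le_top
  · rw [dmul_of_ne_top _ hd', dmul_of_ne_top _ (ne_top_of_le_ne_top hd' hd)]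
    exact mul_le_mul' hs hd

theorem dmul_add (s d d' : ℝ≥0∞) : dmul s (d + d') = dmul s d + dmul s d' := by
  rcases eq_or_ne d ⊤ with rfl | hd
  · rw [top_add, dmul_top, top_add]
  rcases eq_or_ne d' ⊤ with rfl | hd'
  · rw [add_top, dmul_top, add_top]
  rw [dmul_of_ne_top _ hd, dmul_of_ne_top _ hd', dmul_of_ne_top _ (ENNReal.add_ne_top.2 ⟨hd, hd'⟩),
    mul_add]

theorem add_dmul (s s' d : ℝ≥0∞) : dmul (s + s') d = dmul s d + dmul s' d := by
  rcases eq_or_ne d ⊤ with rfl | hd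
  · rw [dmul_top, dmul_top, top_add]
  · rw [dmul_of_ne_top _ hd, dmul_of_ne_top _ hd, dmul_of_ne_top _ hd, add_mul]

theorem mul_le_smul (s t : ℝ≥0∞) : s * t ≤ smul s t := by
  unfold smul
  split_ifs
  · exact le_top
  · exact le_rfl

theorem dmul_dmul_le (s t d : ℝ≥0∞) : dmul s (dmul t d) ≤ dmul (smul s t) d := by
  rcases eq_or_ne d ⊤ with rfl | hd
  · rw [dmul_top (smul s t)]
    exact le_top
  rw [dmul_of_ne_top _ hd, dmul_of_ne_top _ hd]
  rcases eq_or_ne d 0 with rfl | hd0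
  · rw [mul_zero, dmul_zero]
    exact bot_le
  rcases eq_or_ne t ⊤ with rfl | ht
  · have : smul s ⊤ = ⊤ := if_pos (Or.inr rfl)
    rw [this, ENNReal.top_mul hd0]
    exact le_top
  rw [dmul_of_ne_top _ (ENNReal.mul_ne_top ht hd), ← mul_assoc]
  exact mul_le_mul' (mul_le_smul s t) le_rfl

/-- With infinite outer sensitivity a product is `0` or `∞`. -/
theorem dmul_smul_top (t d : ℝ≥0∞) : d = 0 ∨ dmul (smul ⊤ t) d = ⊤ := by
  have : smul ⊤ t = ⊤ := if_pos (Or.inl rfl)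
  rw [this]
  rcases eq_or_ne d ⊤ with rfl | hd
  · exact Or.inr (dmul_top _)
  rcases eq_or_ne d 0 with rfl | hd0
  · exact Or.inl rfl
  · exact Or.inr ((dmul_of_ne_top _ hd).trans (ENNReal.top_mul hd0))

/-! ### Substitution of index terms -/

/-- The value of an index term. -/
noncomputable def Idx.den {φ : List Kind} (ρ : IEnv φ) : (κ : Kind) → Idx φ κ → κ.ty.den
  | .n, S => Size.den ρ S
  | .r, R => Sens.den ρ R

/-- The valuation giving to every index variable the value of the index term substituted for it. -/
noncomputable def ISub.env {φ ψ : List Kind} (s : ISub φ ψ) (ρ : IEnv ψ) : IEnv φ :=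
  fun κ i => (s κ i).den ρ

theorem Size.den_subst {φ ψ : List Kind} (s : ISub φ ψ) (ρ : IEnv ψ) (S : Size φ) :
    (S.subst s).den ρ = S.den (s.env ρ) := by
  induction S with
  | var i => rfl
  | zero => rfl
  | succ S ih => exact congrArg (· + 1) ih

theorem Sens.den_subst {φ ψ : List Kind} (s : ISub φ ψ) (ρ : IEnv ψ) (R : Sens φ) :
    (R.subst s).den ρ = R.den (s.env ρ) := by
  induction R with
  | var i => rfl
  | size S => exact congrArg (Nat.cast (R := ℝ≥0∞)) (S.den_subst s ρ)
  | const r => rfl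
  | infty => rfl
  | add R₁ R₂ ih₁ ih₂ => exact congrArg₂ (· + ·) ih₁ ih₂
  | mul R₁ R₂ ih₁ ih₂ => exact congrArg₂ smul ih₁ ih₂

theorem Idx.den_subst {φ ψ : List Kind} (s : ISub φ ψ) (ρ : IEnv ψ) : (κ : Kind) → (S : Idx φ κ) →
    (S.subst s : Idx ψ κ).den ρ = S.den (s.env ρ)
  | .n, S => Size.den_subst s ρ S
  | .r, R => Sens.den_subst s ρ R

theorem Idx.den_var {φ : List Kind} (ρ : IEnv φ) : (κ : Kind) → (i : Var φ κ) →
    (Idx.var κ i).den ρ = ρ κ i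
  | .n, _ => rfl
  | .r, _ => rfl

theorem ISub.env_wk {φ : List Kind} {κ : Kind} (d : κ.ty.den) (ρ : IEnv φ) :
    (ISub.wk : ISub φ (κ :: φ)).env (ρ.cons d) = ρ := by
  funext κ' i
  exact Idx.den_var _ _ _

theorem ISub.env_lift {φ ψ : List Kind} {κ : Kind} (s : ISub φ ψ) (d : κ.ty.den) (ρ : IEnv ψ) :
    (s.lift : ISub (κ :: φ) (κ :: ψ)).env (ρ.cons d) = (s.env ρ).cons d := by
  funext κ' i
  cases i with
  | z => exact Idx.den_var _ _ _
  | s i => exact (Idx.den_subst _ _ _ _).trans (by rw [ISub.env_wk]; rfl)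

theorem ISub.env_inst {φ : List Kind} {κ : Kind} (S : Idx φ κ) (ρ : IEnv φ) :
    (ISub.inst S).env ρ = ρ.cons (S.den ρ) := by
  funext κ' i
  cases i with
  | z => rfl
  | s i => exact Idx.den_var _ _ _

theorem DTy.D_subst {φ : List Kind} {A : Ty} (σ : DTy φ A) : ∀ {ψ : List Kind} (s : ISub φ ψ)
    (ρ : IEnv ψ), (σ.subst s).D ρ = σ.D (s.env ρ) := by
  induction σ with
  | real => exact fun _ _ => rfl
  | realS R => intro ψ s ρ; simp only [DTy.subst, DTy.D, Sens.den_subst]; rfl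
  | list σ S ih => intro ψ s ρ; simp only [DTy.subst, DTy.D, Size.den_subst, ih]; rfl
  | lolli R σ τ ih₁ ih₂ => intro ψ s ρ; simp only [DTy.subst, DTy.D, Sens.den_subst, ih₁, ih₂]; rfl
  | all κ σ ih => intro ψ s ρ; simp only [DTy.subst, DTy.D, ih, ISub.env_lift]; rfl
  | M => exact fun _ _ => rfl

theorem DTy.D_wk {φ : List Kind} {κ : Kind} {A : Ty} (σ : DTy φ A) (d : κ.ty.den) (ρ : IEnv φ) :
    (σ.subst (ISub.wk (κ := κ))).D (ρ.cons d) = σ.D ρ := by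
  rw [DTy.D_subst, ISub.env_wk]

theorem Constrs.sat_wk {φ : List Kind} {κ : Kind} {Φ : Constrs φ} {ρ : IEnv φ} (h : Φ.Sat ρ)
    (d : κ.ty.den) : (Φ.wk (κ := κ)).Sat (ρ.cons d) := by
  intro c hc
  obtain ⟨c', hc', rfl⟩ := List.mem_map.1 hc
  simpa only [Size.den_subst, ISub.env_wk] using h c' hc'

theorem Constrs.sat_add {φ : List Kind} {Φ : Constrs φ} {ρ : IEnv φ} (h : Φ.Sat ρ) {S₁ S₂ : Size φ}
    (hS : S₁.den ρ = S₂.den ρ) : (Φ.add S₁ S₂).Sat ρ :=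
  List.forall_mem_cons.2 ⟨hS, h⟩

/-! ### Translation of index terms -/

/-- The values of the expressions put for the index variables. -/
noncomputable def IMap.env {φ : List Kind} {Δ : List Ty} (s : IMap φ Δ) (θ : Env Δ) : IEnv φ :=
  fun κ i => (s κ i).den θ

theorem IMap.env_wk {φ : List Kind} {Δ : List Ty} {B : Ty} (s : IMap φ Δ) (d : B.den) (θ : Env Δ) :
    (s.wk).env (Env.cons d θ) = s.env θ := by
  funext κ i
  exact Tm.den_wk _ _ _

theorem IMap.env_cons {φ : List Kind} {Δ : List Ty} {κ : Kind} (e : Tm Δ κ.ty) (s : IMap φ Δ)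
    (θ : Env Δ) : (IMap.cons e s).env θ = (s.env θ).cons (e.den θ) := by
  funext κ' i
  cases i <;> rfl

theorem Size.den_trans {φ : List Kind} {Δ : List Ty} (s : IMap φ Δ) (θ : Env Δ) (S : Size φ) :
    (S.trans s).den θ = S.den (s.env θ) := by
  induction S with
  | var i => rfl
  | zero => rfl
  | succ S ih => exact congrArg (· + 1) ih

theorem Sens.den_trans {φ : List Kind} {Δ : List Ty} (s : IMap φ Δ) (θ : Env Δ) (R : Sens φ) :
    (R.trans s).den θ = R.den (s.env θ) := by
  induction R with
  | var i => rfl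
  | size S => exact congrArg (Nat.cast (R := ℝ≥0∞)) (S.den_trans s θ)
  | const r => rfl
  | infty => rfl
  | add R₁ R₂ ih₁ ih₂ => exact congrArg₂ (· + ·) ih₁ ih₂
  | mul R₁ R₂ ih₁ ih₂ => exact congrArg₂ smul ih₁ ih₂

theorem Idx.den_trans {φ : List Kind} {Δ : List Ty} (s : IMap φ Δ) (θ : Env Δ) : (κ : Kind) →
    (S : Idx φ κ) → (Idx.trans s κ S).den θ = S.den (s.env θ)
  | .n, S => Size.den_trans s θ S
  | .r, R => Sens.den_trans s θ R

/-! ### Distances of environments -/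

/-- The distance `R ⋄ D_σ(a, b)` contributed by a binding `x :!_R σ`. -/
noncomputable def entryCost {φ : List Kind} {A : Ty} (ρ : IEnv φ) (a b : A.den) :
    Option (Sens φ × DTy φ A) → ℝ≥0∞
  | none => 0
  | some p => dmul (p.1.den ρ) (p.2.D ρ a b)

/-- The distance `∑ R ⋄ D_σ(x₁, x₂)` of two valuations, over the bindings `x :!_R σ` of an
environment. -/
noncomputable def DCtx.cost {φ : List Kind} (ρ : IEnv φ) : {Γ : List Ty} → DCtx φ Γ →
    Env Γ → Env Γ → ℝ≥0∞
  | [], _, _, _ => 0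
  | A :: _, Δ, γ₁, γ₂ => entryCost ρ (γ₁ A .z) (γ₂ A .z) (Δ A .z) +
      DCtx.cost ρ (fun B x => Δ B (.s x)) γ₁.tail γ₂.tail

theorem DCtx.cost_cons {φ : List Kind} {Γ : List Ty} {A : Ty} (ρ : IEnv φ) (R : Sens φ)
    (σ : DTy φ A) (Δ : DCtx φ Γ) (a b : A.den) (γ₁ γ₂ : Env Γ) :
    (Δ.cons R σ).cost ρ (Env.cons a γ₁) (Env.cons b γ₂) =
      dmul (R.den ρ) (σ.D ρ a b) + Δ.cost ρ γ₁ γ₂ := rfl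

theorem DCtx.entryCost_le_cost {φ : List Kind} {ρ : IEnv φ} {Γ : List Ty} {A : Ty} (x : Var Γ A) :
    ∀ (Δ : DCtx φ Γ) (γ₁ γ₂ : Env Γ),
      entryCost ρ (γ₁ A x) (γ₂ A x) (Δ A x) ≤ Δ.cost ρ γ₁ γ₂ := by
  induction x with
  | z => exact fun Δ γ₁ γ₂ => le_self_add
  | s x ih => exact fun Δ γ₁ γ₂ => (ih (fun B x => Δ B (.s x)) γ₁.tail γ₂.tail).trans le_add_self

theorem DCtx.cost_mono {φ ψ : List Kind} {ρ : IEnv φ} {ρ' : IEnv ψ} : {Γ : List Ty} →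
    {Δ : DCtx φ Γ} → {Δ' : DCtx ψ Γ} → {γ₁ γ₂ : Env Γ} →
    (∀ A x, entryCost ρ (γ₁ A x) (γ₂ A x) (Δ A x) ≤ entryCost ρ' (γ₁ A x) (γ₂ A x) (Δ' A x)) →
    Δ.cost ρ γ₁ γ₂ ≤ Δ'.cost ρ' γ₁ γ₂
  | [], _, _, _, _, _ => le_rfl
  | _ :: _, _, _, _, _, h => add_le_add (h _ .z) (DCtx.cost_mono fun A x => h A (.s x))

theorem DCtx.cost_wk {φ : List Kind} {κ : Kind} {Γ : List Ty} (Δ : DCtx φ Γ) (ρ : IEnv φ)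
    (d : κ.ty.den) (γ₁ γ₂ : Env Γ) :
    (Δ.wk (κ := κ)).cost (ρ.cons d) γ₁ γ₂ ≤ Δ.cost ρ γ₁ γ₂ := by
  refine DCtx.cost_mono fun A x => ?_
  unfold DCtx.wk
  cases Δ A x with
  | none => exact le_rfl
  | some p =>
    show dmul ((p.1.subst ISub.wk).den _) ((p.2.subst ISub.wk).D _ _ _) ≤ _
    rw [Sens.den_subst, DTy.D_wk, ISub.env_wk]
    exact le_rfl

theorem DCtx.dmul_cost_le {φ : List Kind} (ρ : IEnv φ) (R : Sens φ) : {Γ : List Ty} →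
    (Δ : DCtx φ Γ) → (γ₁ γ₂ : Env Γ) →
    dmul (R.den ρ) (Δ.cost ρ γ₁ γ₂) ≤ (Δ.scale R).cost ρ γ₁ γ₂
  | [], _, _, _ => (dmul_zero _).le
  | A :: Γ, Δ, γ₁, γ₂ => by
    refine (dmul_add _ _ _).le.trans (add_le_add ?_
      (DCtx.dmul_cost_le ρ R (fun B x => Δ B (.s x)) γ₁.tail γ₂.tail))
    unfold DCtx.scale
    cases Δ A .z with
    | none => exact (dmul_zero _).le
    | some p => exact dmul_dmul_le _ _ _

/-- Scaled by `∞`, an environment is at distance `0`, already before scaling, or at distance `∞`. -/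
theorem DCtx.cost_scale_infty {φ : List Kind} (ρ : IEnv φ) : {Γ : List Ty} →
    (Δ : DCtx φ Γ) → (γ₁ γ₂ : Env Γ) →
    Δ.cost ρ γ₁ γ₂ = 0 ∨ (Δ.scale .infty).cost ρ γ₁ γ₂ = ⊤
  | [], _, _, _ => Or.inl rfl
  | A :: Γ, Δ, γ₁, γ₂ => by
    have h : entryCost ρ (γ₁ A .z) (γ₂ A .z) (Δ A .z) = 0 ∨
        entryCost ρ (γ₁ A .z) (γ₂ A .z) (Δ.scale .infty A .z) = ⊤ := by
      unfold DCtx.scale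
      cases Δ A .z with
      | none => exact Or.inl rfl
      | some p =>
        refine (dmul_smul_top (p.1.den ρ) _).imp_left fun h => ?_
        show dmul _ _ = 0
        rw [h, dmul_zero]
    rcases h with h | h
    · refine (DCtx.cost_scale_infty ρ (fun B x => Δ B (.s x)) γ₁.tail γ₂.tail).imp
        (fun h' => ?_) fun h' => ?_
      · show _ + _ = _
        rw [h, h', add_zero]
      · show _ + _ = _
        exact (congrArg _ h').trans (add_top _)
    · exact Or.inr (by show _ + _ = _; rw [h, top_add])

theorem DCtx.IsAdd.cost_eq {φ : List Kind} {ρ : IEnv φ} : {Γ : List Ty} → {Δ₁ Δ₂ Δ : DCtx φ Γ} →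
    DCtx.IsAdd Δ₁ Δ₂ Δ → (γ₁ γ₂ : Env Γ) →
    Δ.cost ρ γ₁ γ₂ = Δ₁.cost ρ γ₁ γ₂ + Δ₂.cost ρ γ₁ γ₂
  | [], _, _, _, _, _, _ => (add_zero _).symm
  | A :: Γ, Δ₁, Δ₂, Δ, h, γ₁, γ₂ => by
    have h₁ : entryCost ρ (γ₁ A .z) (γ₂ A .z) (Δ A .z) = entryCost ρ (γ₁ A .z) (γ₂ A .z) (Δ₁ A .z) +
        entryCost ρ (γ₁ A .z) (γ₂ A .z) (Δ₂ A .z) := by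
      have := h A .z
      revert this
      generalize Δ A .z = o, Δ₁ A .z = o₁, Δ₂ A .z = o₂
      intro this
      cases this with
      | both R₁ R₂ σ => exact add_dmul _ _ _
      | left p => exact (add_zero _).symm
      | right p => exact (zero_add _).symm
      | none => exact (add_zero _).symm
    have h₂ := DCtx.IsAdd.cost_eq (ρ := ρ) (Δ₁ := fun B x => Δ₁ B (.s x))
      (Δ₂ := fun B x => Δ₂ B (.s x)) (Δ := fun B x => Δ B (.s x)) (fun B x => h B (.s x))
      γ₁.tail γ₂.tail
    show _ + _ = (_ + _) + (_ + _)
    rw [h₁, h₂, add_add_add_comm]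

/-! ### The distance of probability distributions -/

theorem eexp_of_ne_top {ε : ℝ≥0∞} (hε : ε ≠ ⊤) : eexp ε = ENNReal.ofReal (Real.exp ε.toReal) :=
  if_neg hε

theorem eexp_add {ε ε' : ℝ≥0∞} (hε : ε ≠ ⊤) (hε' : ε' ≠ ⊤) :
    eexp (ε + ε') = eexp ε * eexp ε' := by
  rw [eexp_of_ne_top hε, eexp_of_ne_top hε', eexp_of_ne_top (ENNReal.add_ne_top.2 ⟨hε, hε'⟩),
    ENNReal.toReal_add hε hε', Real.exp_add, ENNReal.ofReal_mul (Real.exp_pos _).le]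

theorem absLogRatio_le_iff {a b ε : ℝ≥0∞} (ha : a ≠ ⊤) (hb : b ≠ ⊤) (hε : ε ≠ ⊤) :
    absLogRatio a b ≤ ε ↔ a ≤ eexp ε * b ∧ b ≤ eexp ε * a := by
  unfold absLogRatio
  split_ifs with h h0
  · subst h
    exact ⟨fun _ => ⟨le_mul_of_one_le_left' (one_le_eexp ε),
        le_mul_of_one_le_left' (one_le_eexp ε)⟩,
      fun _ => bot_le⟩
  · refine ⟨fun h' => (hε (top_le_iff.1 h')).elim, fun h' => (h ?_).elim⟩
    rcases h0 with rfl | rfl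
    · simpa [eq_comm] using h'.2
    · simpa using h'.1
  · push Not at h0
    lift a to ℝ≥0 using ha
    lift b to ℝ≥0 using hb
    lift ε to ℝ≥0 using hε
    have ha : (0 : ℝ) < a := NNReal.coe_pos.2 (pos_iff_ne_zero.2 (by simpa using h0.1))
    have hb : (0 : ℝ) < b := NNReal.coe_pos.2 (pos_iff_ne_zero.2 (by simpa using h0.2))
    have key : ∀ x y : ℝ≥0, (x : ℝ≥0∞) ≤ eexp ε * y ↔ (x : ℝ) ≤ Real.exp ε * y := fun x y => by
      rw [eexp_of_ne_top ENNReal.coe_ne_top, ENNReal.coe_toReal,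
        ← ENNReal.ofReal_coe_nnreal (p := y),
        ← ENNReal.ofReal_mul (Real.exp_pos _).le, ← ENNReal.ofReal_coe_nnreal (p := x),
        ENNReal.ofReal_le_ofReal_iff (by positivity)]
    rw [key, key, ENNReal.coe_toReal, ENNReal.coe_toReal, ENNReal.ofReal_le_iff_le_toReal
      ENNReal.coe_ne_top, ENNReal.coe_toReal, abs_le', ← Real.log_inv, inv_div,
      Real.log_le_iff_le_exp (div_pos ha hb), Real.log_le_iff_le_exp (div_pos hb ha),
      div_le_iff₀ hb, div_le_iff₀ ha]

theorem iSup_absLogRatio_le_iff {α : Type} {μ ν : PMF α} {ε : ℝ≥0∞} (hε : ε ≠ ⊤) :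
    ⨆ x, absLogRatio (μ x) (ν x) ≤ ε ↔ ∀ x, μ x ≤ eexp ε * ν x ∧ ν x ≤ eexp ε * μ x :=
  iSup_le_iff.trans (forall_congr' fun x =>
    absLogRatio_le_iff (μ.apply_ne_top x) (ν.apply_ne_top x) hε)

theorem bind_apply_le {α β : Type} {μ ν : PMF α} {k l : α → PMF β} {c c' : ℝ≥0∞}
    (h : ∀ x, μ x ≤ c * ν x) (h' : ∀ x y, k x y ≤ c' * l x y) (y : β) :
    μ.bind k y ≤ c * c' * ν.bind l y := by
  rw [PMF.bind_apply, PMF.bind_apply, ← ENNReal.tsum_mul_left]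
  refine ENNReal.tsum_le_tsum fun x => (mul_le_mul' (h x) (h' x y)).trans ?_
  rw [mul_mul_mul_comm]

/-- Sequential composition of pure differential privacy. -/
theorem iSup_absLogRatio_bind_le {α β : Type} {μ ν : PMF α} {k l : α → PMF β} {ε ε' : ℝ≥0∞}
    (h : ⨆ x, absLogRatio (μ x) (ν x) ≤ ε) (h' : ∀ x, ⨆ y, absLogRatio (k x y) (l x y) ≤ ε') :
    ⨆ y, absLogRatio (μ.bind k y) (ν.bind l y) ≤ ε + ε' := by
  rcases eq_or_ne ε ⊤ with rfl | hε
  · exact le_top.trans_eq (top_add _).symm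
  rcases eq_or_ne ε' ⊤ with rfl | hε'
  · exact le_top.trans_eq (add_top _).symm
  rw [iSup_absLogRatio_le_iff hε] at h
  simp only [iSup_absLogRatio_le_iff hε'] at h'
  rw [iSup_absLogRatio_le_iff (ENNReal.add_ne_top.2 ⟨hε, hε'⟩), eexp_add hε hε']
  exact fun y => ⟨bind_apply_le (fun x => (h x).1) (fun x y => (h' x y).1) y,
    bind_apply_le (fun x => (h x).2) (fun x y => (h' x y).2) y⟩

/-- Distributions with ratios bounded by `exp ε` are related by the lifting of equality; the witness
is the pointwise minimum, placed on the diagonal. -/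
theorem Lifting.eq_of_iSup_absLogRatio_le {α : Type} {μ ν : PMF α} {ε : ℝ≥0∞} (hε : ε ≠ ⊤)
    {Ψ : α → α → Prop} (hΨ : ∀ a, Ψ a a) (h : ⨆ x, absLogRatio (μ x) (ν x) ≤ ε) :
    Lifting ε 0 Ψ μ ν := by
  classical
  rw [iSup_absLogRatio_le_iff hε] at h
  have h₁ : ∀ a, ∑' b, (if a = b then min (μ a) (ν a) else 0) = min (μ a) (ν a) := fun a => by
    rw [tsum_eq_single a (fun b hb => if_neg hb.symm), if_pos rfl]
  have h₂ : ∀ b, ∑' a, (if a = b then min (μ a) (ν a) else 0) = min (μ b) (ν b) := fun b => by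
    rw [tsum_eq_single b (fun a ha => if_neg ha), if_pos rfl]
  refine ⟨fun p => if p.1 = p.2 then min (μ p.1) (ν p.1) else 0, ?_, fun a b hab => ?_,
    fun a => (h₁ a).trans_le (min_le_left _ _), fun b => (h₂ b).trans_le (min_le_right _ _), ?_, ?_⟩
  · rw [ENNReal.tsum_prod (f := fun a b => if a = b then min (μ a) (ν a) else 0)]
    simp only [h₁]
    exact (ENNReal.tsum_le_tsum fun a => min_le_left _ _).trans_eq μ.tsum_coe
  · by_cases hab' : a = b
    · exact hab' ▸ hΨ a
    · simp [hab'] at hab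
  · refine (epsDist_eq_zero fun a => ?_).le
    simp only [h₁]
    rcases min_choice (μ a) (ν a) with h' | h' <;> rw [h']
    · exact le_mul_of_one_le_left' (one_le_eexp ε)
    · exact (h a).1
  · refine (epsDist_eq_zero fun b => ?_).le
    simp only [h₂]
    rcases min_choice (μ b) (ν b) with h' | h' <;> rw [h']
    · exact (h b).2
    · exact le_mul_of_one_le_left' (one_le_eexp ε)

/-! ### Distances of functions, subtyping and limits -/

theorem DTy.D_lolli_le_iff {φ : List Kind} {A B : Ty} {R : Sens φ} {σ : DTy φ A} {τ : DTy φ B}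
    {ρ : IEnv φ} {f g : A.den → B.den} {c : ℝ≥0∞} :
    (DTy.lolli R σ τ).D ρ f g ≤ c ↔
      ∀ a b, τ.D ρ (f a) (g b) ≤ c + dmul (R.den ρ) (σ.D ρ a b) := by
  refine iSup₂_le_iff.trans (forall₂_congr fun a b => tsub_le_iff_right)

theorem DTy.D_all_le_iff {φ : List Kind} {A : Ty} {κ : Kind} {σ : DTy (κ :: φ) A}
    {ρ : IEnv φ} {f g : κ.ty.den → A.den} {c : ℝ≥0∞} :
    (DTy.all κ σ).D ρ f g ≤ c ↔ ∀ d, σ.D (ρ.cons d) (f d) (g d) ≤ c :=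
  iSup_le_iff

theorem DTy.D_list_of_length {φ : List Kind} {A : Ty} {σ : DTy φ A} {S : Size φ} {ρ : IEnv φ}
    {l l' : List A.den} (h : l.length = S.den ρ) (h' : l'.length = S.den ρ) :
    (DTy.list σ S).D ρ l l' = (List.zipWith (σ.D ρ) l l').sum :=
  if_pos ⟨h, h'⟩

theorem DTy.length_of_D_list_ne_top {φ : List Kind} {A : Ty} {σ : DTy φ A} {S : Size φ} {ρ : IEnv φ}
    {l l' : List A.den} (h : (DTy.list σ S).D ρ l l' ≠ ⊤) :
    l.length = S.den ρ ∧ l'.length = S.den ρ := by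
  by_contra hl
  exact h (if_neg hl)

theorem sum_zipWith_mono {α : Type} {d d' : α → α → ℝ≥0∞} (h : ∀ a b, d a b ≤ d' a b) :
    ∀ l l' : List α, (List.zipWith d l l').sum ≤ (List.zipWith d' l l').sum
  | [], _ => le_rfl
  | _ :: _, [] => le_rfl
  | a :: l, b :: l' => by
    simp only [List.zipWith_cons_cons, List.sum_cons]
    exact add_le_add (h a b) (sum_zipWith_mono h l l')

/-- Distances decrease along subtyping. -/
theorem DSub.D_le {φ : List Kind} {A : Ty} {Φ : Constrs φ} {σ σ' : DTy φ A} (h : DSub Φ σ σ') :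
    ∀ {ρ : IEnv φ}, Φ.Sat ρ → ∀ a b : A.den, σ'.D ρ a b ≤ σ.D ρ a b := by
  induction h with
  | refl => exact fun _ _ _ => le_rfl
  | trans _ _ ih₁ ih₂ => exact fun hρ a b => (ih₂ hρ a b).trans (ih₁ hρ a b)
  | forget Φ R =>
    intro ρ _ (a : ℝ) (b : ℝ)
    show ENNReal.ofReal |a - b| ≤ ite _ _ _
    split_ifs with h
    · rw [h.1, sub_self, abs_zero, ENNReal.ofReal_zero]
    · exact le_top
  | realS h =>
    intro ρ hρ (a : ℝ) (b : ℝ)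
    unfold DTy.D
    rw [h ρ hρ]
  | @list φ A Φ σ σ' S S' _ hS ih =>
    intro ρ hρ (l : List A.den) (l' : List A.den)
    rcases eq_or_ne ((DTy.list σ S).D ρ l l') ⊤ with h | h
    · rw [h]
      exact le_top
    · obtain ⟨h₁, h₂⟩ := DTy.length_of_D_list_ne_top h
      rw [DTy.D_list_of_length h₁ h₂,
        DTy.D_list_of_length (h₁.trans (hS ρ hρ)) (h₂.trans (hS ρ hρ))]
      exact sum_zipWith_mono (ih hρ) l l'
  | lolli hR _ _ ih₁ ih₂ =>
    exact fun hρ f g => DTy.D_lolli_le_iff.2 fun a b => (ih₂ hρ _ _).trans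
      ((DTy.D_lolli_le_iff.1 le_rfl a b).trans
        (add_le_add_right (dmul_mono (hR _ hρ) (ih₁ hρ a b)) _))
  | all _ ih =>
    exact fun hρ f g => DTy.D_all_le_iff.2 fun d => (ih (Constrs.sat_wk hρ d) _ _).trans
      (DTy.D_all_le_iff.1 le_rfl d)

/-- Balls are closed under limits of approximations. -/
theorem DTy.D_le_of_conv {φ : List Kind} {A : Ty} (σ : DTy φ A) : ∀ {ρ : IEnv φ} {u v : ℕ → A.den}
    {a b : A.den} {c : ℝ≥0∞}, A.Conv u a → A.Conv v b → (∀ k, σ.D ρ (u k) (v k) ≤ c) →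
    σ.D ρ a b ≤ c := by
  induction σ with
  | lolli R σ τ ihσ ihτ =>
    exact fun hu hv h => DTy.D_lolli_le_iff.2 fun a b =>
      ihτ (hu a) (hv b) fun k => DTy.D_lolli_le_iff.1 (h k) a b
  | all κ σ ih =>
    exact fun hu hv h => DTy.D_all_le_iff.2 fun d =>
      ih (hu d) (hv d) fun k => DTy.D_all_le_iff.1 (h k) d
  | _ =>
    intro ρ u v a b c hu hv h
    obtain ⟨k, hk, hk'⟩ := (Filter.Eventually.and hu hv).exists
    exact hk ▸ hk' ▸ h k

/-- Two recursive definitions are at distance `0` if their functionals preserve distance `0` and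
there is an approximation at distance `0` from itself to start from. -/
theorem IsRec.D_eq_zero {φ : List Kind} {A B : Ty} {σ : DTy φ (.fn A B)} {ρ : IEnv φ}
    {F G : (A.den → B.den) → A.den → B.den} {f g : A.den → B.den} (hf : IsRec A B F f)
    (hg : IsRec A B G g) (h₀ : ∃ k, σ.D ρ k k = 0)
    (h : ∀ f g, σ.D ρ f g = 0 → σ.D ρ (F f) (G g) = 0) : σ.D ρ f g = 0 := by
  obtain ⟨k, hk⟩ := h₀
  refine le_antisymm (σ.D_le_of_conv (hf.2 k) (hg.2 k) fun n => le_of_eq ?_) bot_le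
  induction n with
  | zero => exact hk
  | succ n ih =>
    exact (congrArg₂ (σ.D ρ) (Function.iterate_succ_apply' F n k)
      (Function.iterate_succ_apply' G n k)).trans (h _ _ ih)

/-! ### Metric preservation -/

theorem DTy.D_real_eq_zero_iff {φ : List Kind} {ρ : IEnv φ} {a b : ℝ} :
    (DTy.real (φ := φ)).D ρ a b = 0 ↔ a = b :=
  ENNReal.ofReal_eq_zero.trans (abs_nonpos_iff.trans sub_eq_zero)

theorem DTy.D_list_cons {φ ψ : List Kind} {A : Ty} {σ : DTy φ A} {σ' : DTy ψ A} {S : Size φ}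
    {S' : Size ψ} {ρ : IEnv φ} {ρ' : IEnv ψ} (hS : S'.den ρ' = S.den ρ + 1) (hσ : σ'.D ρ' = σ.D ρ)
    (a b : A.den) (l l' : List A.den) :
    (DTy.list σ' S').D ρ' (a :: l : List A.den) (b :: l' : List A.den) =
      σ.D ρ a b + (DTy.list σ S).D ρ l l' := by
  simp only [DTy.D, List.length_cons, hS, add_left_inj, List.zipWith_cons_cons, List.sum_cons, hσ]
  split_ifs
  · rfl
  · exact (add_top _).symm

theorem entryCost_mono {φ : List Kind} {A : Ty} {Φ : Constrs φ} {ρ : IEnv φ} (hρ : Φ.Sat ρ)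
    {o o' : Option (Sens φ × DTy φ A)} (h : EntryLe Φ o o') (a b : A.den) :
    entryCost ρ a b o ≤ entryCost ρ a b o' := by
  cases h with
  | none => exact bot_le
  | some hR hσ => exact dmul_mono (hR ρ hρ) (hσ.D_le hρ a b)

/-- The value of a recursive definition which passes the termination guard. -/
theorem Tm.SNGuard.isRec {Γ : List Ty} {A B : Ty} {e : Tm (A :: .fn A B :: Γ) B} (h : e.SNGuard)
    (θ : Env Γ) : IsRec A B (fun g d => e.den (Env.cons d (Env.cons (A := .fn A B) g θ)))
      ((Tm.letrec e).den θ) :=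
  Classical.epsilon_spec (h θ)

/-- Metric preservation: the distance of the values of `e` in two valuations is at most the
distance of the valuations, measured with the sensitivities of the environment. -/
theorem DTyping.D_le_cost {φ : List Kind} {Γ : List Ty} {A : Ty} {Φ : Constrs φ} {Δ : DCtx φ Γ}
    {e : DExp φ Γ A} {σ : DTy φ A} (h : DTyping Φ Δ e σ) :
    ∀ {Ξ : List Ty} (s : IMap φ Ξ) (t : Sub Γ Ξ), (e.trans s t).SimplyTyped →
      ∀ (θ₁ θ₂ : Env Ξ) (ρ : IEnv φ), s.env θ₁ = ρ → s.env θ₂ = ρ → Φ.Sat ρ →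
        σ.D ρ ((e.trans s t).den θ₁) ((e.trans s t).den θ₂) ≤ Δ.cost ρ (t.env θ₁) (t.env θ₂) := by
  induction h with
  | @var φ Γ A Φ Δ σ x hx =>
    intro Ξ s t _ θ₁ θ₂ ρ _ _ _
    refine le_trans ?_ (Δ.entryCost_le_cost x _ _)
    rw [hx]
    exact (dmul_one_left _).symm.le
  | const Φ Δ r =>
    intro Ξ s t _ θ₁ θ₂ ρ _ _ _
    refine (le_of_eq ?_).trans bot_le
    exact if_pos ⟨rfl, r.2, ENNReal.ofReal_coe_nnreal⟩
  | lam _ ih =>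
    intro Ξ s t he θ₁ θ₂ ρ h₁ h₂ hρ
    refine DTy.D_lolli_le_iff.2 fun a b => ?_
    have := ih s.wk t.lift he (Env.cons a θ₁) (Env.cons b θ₂) ρ ((s.env_wk _ _).trans h₁)
      ((s.env_wk _ _).trans h₂) hρ
    rw [Sub.env_lift, Sub.env_lift, DCtx.cost_cons, add_comm] at this
    exact this
  | app _ _ hadd ih₁ ih₂ =>
    intro Ξ s t he θ₁ θ₂ ρ h₁ h₂ hρ
    rw [hadd.cost_eq]
    refine (DTy.D_lolli_le_iff.1 (ih₁ s t he.1 θ₁ θ₂ ρ h₁ h₂ hρ) _ _).trans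
      (add_le_add_right ?_ _)
    exact (dmul_mono le_rfl (ih₂ s t he.2 θ₁ θ₂ ρ h₁ h₂ hρ)).trans (DCtx.dmul_cost_le _ _ _ _ _)
  | @letrec φ Γ A B Φ Δ R σ τ e hne _ ih =>
    intro Ξ s t he θ₁ θ₂ ρ h₁ h₂ hρ
    -- Only valuations at distance `0` matter, and there the functionals preserve distance `0`.
    rcases Δ.cost_scale_infty ρ (t.env θ₁) (t.env θ₂) with h0 | h0
    swap
    · exact le_top.trans_eq h0.symm
    refine le_trans (le_of_eq ?_) bot_le
    refine IsRec.D_eq_zero (he.2.isRec θ₁) (he.2.isRec θ₂) (hne ρ hρ) fun f g hfg => ?_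
    refine le_antisymm (DTy.D_lolli_le_iff.2 fun a b => ?_) bot_le
    have := ih s.wk.wk t.lift.lift he.1 (Env.cons a (Env.cons f θ₁)) (Env.cons b (Env.cons g θ₂)) ρ
      ((IMap.env_wk _ _ _).trans ((s.env_wk _ _).trans h₁))
      ((IMap.env_wk _ _ _).trans ((s.env_wk _ _).trans h₂)) hρ
    rw [Sub.env_lift_lift, Sub.env_lift_lift, DCtx.cost_cons, DCtx.cost_cons, hfg, dmul_zero, h0,
      add_zero, add_comm] at this
    exact this
  | @letrecI φ Γ A Φ Δ κ σ e hne _ ih =>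
    intro Ξ s t he θ₁ θ₂ ρ h₁ h₂ hρ
    rcases Δ.cost_scale_infty ρ (t.env θ₁) (t.env θ₂) with h0 | h0
    swap
    · exact le_top.trans_eq h0.symm
    refine le_trans (le_of_eq ?_) bot_le
    refine IsRec.D_eq_zero (he.2.isRec θ₁) (he.2.isRec θ₂) (hne ρ hρ) fun f g hfg => ?_
    refine le_antisymm (DTy.D_all_le_iff.2 fun d => ?_) bot_le
    have hs : ∀ (θ : Env Ξ) (k : (Ty.fn κ.ty A).den), s.env θ = ρ →
        (IMap.cons (.var .z) s.wk.wk).env (Env.cons d (Env.cons k θ)) = ρ.cons d := by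
      intro θ k h
      rw [IMap.env_cons, IMap.env_wk, IMap.env_wk, h]
      rfl
    have ht : ∀ (θ : Env Ξ) (k : (Ty.fn κ.ty A).den),
        Sub.env (Sub.cons (.var (.s .z)) fun _ x => (t _ x).wk.wk)
          (Env.cons d (Env.cons k θ)) = Env.cons k (t.env θ) := by
      intro θ k
      funext B x
      cases x with
      | z => rfl
      | s x => exact (Tm.den_wk _ _ _).trans (Tm.den_wk _ _ _)
    have := ih _ _ he.1 (Env.cons d (Env.cons f θ₁)) (Env.cons d (Env.cons g θ₂)) (ρ.cons d)
      (hs θ₁ f h₁) (hs θ₂ g h₂) (Constrs.sat_wk hρ d)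
    rw [ht, ht, DCtx.cost_cons, DTy.D_wk, hfg, dmul_zero, zero_add] at this
    exact this.trans ((DCtx.cost_wk _ _ _ _ _).trans h0.le)
  | @ilam φ Γ A Φ Δ κ σ e _ ih =>
    intro Ξ s t he θ₁ θ₂ ρ h₁ h₂ hρ
    refine DTy.D_all_le_iff.2 fun d => ?_
    have hs : ∀ θ : Env Ξ, s.env θ = ρ →
        (IMap.cons (.var .z) s.wk).env (Env.cons d θ) = ρ.cons d := by
      intro θ h
      rw [IMap.env_cons, IMap.env_wk, h]
      rfl
    have ht : ∀ θ : Env Ξ, Sub.env (fun _ x => (t _ x).wk) (Env.cons d θ) = t.env θ := by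
      intro θ
      funext B x
      exact Tm.den_wk _ _ _
    have := ih _ _ he (Env.cons d θ₁) (Env.cons d θ₂) (ρ.cons d) (hs θ₁ h₁) (hs θ₂ h₂)
      (Constrs.sat_wk hρ d)
    rw [ht, ht] at this
    exact this.trans (DCtx.cost_wk _ _ _ _ _)
  | @iapp φ Γ A Φ Δ κ σ e S _ ih =>
    intro Ξ s t he θ₁ θ₂ ρ h₁ h₂ hρ
    have := DTy.D_all_le_iff.1 (ih s t he.1 θ₁ θ₂ ρ h₁ h₂ hρ) (S.den ρ)
    rw [DTy.D_subst, ISub.env_inst]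
    have hS₁ : (Idx.trans s κ S).den θ₁ = S.den ρ := by rw [Idx.den_trans, h₁]
    have hS₂ : (Idx.trans s κ S).den θ₂ = S.den ρ := by rw [Idx.den_trans, h₂]
    simp only [DExp.trans, Tm.den, hS₁, hS₂]
    exact this
  | @ret φ Γ Φ Δ e _ ih =>
    intro Ξ s t he θ₁ θ₂ ρ h₁ h₂ hρ
    rcases Δ.cost_scale_infty ρ (t.env θ₁) (t.env θ₂) with h0 | h0
    swap
    · exact le_top.trans_eq h0.symm
    have h := (ih s t he θ₁ θ₂ ρ h₁ h₂ hρ).trans h0.le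
    have h' : (e.trans s t).den θ₁ = (e.trans s t).den θ₂ :=
      DTy.D_real_eq_zero_iff.1 (le_bot_iff.1 h)
    refine le_trans (iSup_le fun x => ?_) bot_le
    show absLogRatio (PMF.pure ((e.trans s t).den θ₁) x) (PMF.pure ((e.trans s t).den θ₂) x) ≤ 0
    rw [h']
    exact (if_pos rfl).le
  | @mlet φ Γ Φ Δ₁ Δ₂ Δ e₁ e₂ _ _ hadd ih₁ ih₂ =>
    intro Ξ s t he θ₁ θ₂ ρ h₁ h₂ hρ
    rw [hadd.cost_eq]
    refine iSup_absLogRatio_bind_le (ih₁ s t he.1 θ₁ θ₂ ρ h₁ h₂ hρ) fun x => ?_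
    -- Pointwise composition only compares the continuations at equal arguments.
    have := ih₂ s.wk t.lift he.2 (Env.cons x θ₁) (Env.cons x θ₂) ρ ((s.env_wk _ _).trans h₁)
      ((s.env_wk _ _).trans h₂) hρ
    have hx : (DTy.real (φ := φ)).D ρ x x = 0 := DTy.D_real_eq_zero_iff.2 rfl
    rw [Sub.env_lift, Sub.env_lift, DCtx.cost_cons, hx, dmul_zero, zero_add] at this
    exact this
  | nil Φ Δ σ =>
    intro Ξ s t _ θ₁ θ₂ ρ _ _ _
    exact (DTy.D_list_of_length (S := .zero) (l := []) (l' := []) rfl rfl).trans_le bot_le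
  | @cons φ Γ A Φ Δ₁ Δ₂ Δ σ S e₁ e₂ _ _ hadd ih₁ ih₂ =>
    intro Ξ s t he θ₁ θ₂ ρ h₁ h₂ hρ
    rw [hadd.cost_eq]
    have h := ih₂ s t he.2 θ₁ θ₂ ρ h₁ h₂ hρ
    refine le_trans ?_ (add_le_add (ih₁ s t he.1.2 θ₁ θ₂ ρ h₁ h₂ hρ) h)
    exact (DTy.D_list_cons rfl rfl _ _ _ _).le
  | @case φ Γ A B Φ Δ₁ Δ₂ Δ R σ S τ e e₁ e₂ _ _ _ hadd ih ih₁ ih₂ =>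
    intro Ξ s t he θ₁ θ₂ ρ h₁ h₂ hρ
    rw [hadd.cost_eq]
    have hle := (dmul_mono (le_refl (R.den ρ)) (ih s t he.1 θ₁ θ₂ ρ h₁ h₂ hρ)).trans
      (Δ₂.dmul_cost_le _ R _ _)
    -- At infinite distance of the scrutinees the bound is infinite; otherwise both have length `S`.
    rcases eq_or_ne ((DTy.list σ S).D ρ ((e.trans s t).den θ₁) ((e.trans s t).den θ₂)) ⊤ with
      htop | htop
    · rw [htop, dmul_top, top_le_iff] at hle
      rw [hle, add_top]
      exact le_top
    obtain ⟨hl₁, hl₂⟩ := DTy.length_of_D_list_ne_top htop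
    refine le_trans ?_ (add_le_add_right hle _)
    have ih₁' := ih₁ s t he.2.1 θ₁ θ₂ ρ h₁ h₂
    -- The index bound by the second branch is the length of both tails.
    have ih₂' : ∀ (n : Kind.n.ty.den) (a b : A.den) (l₁ l₂ : (Ty.list A).den),
        List.length l₁ = n → List.length l₂ = n → S.den ρ = Nat.succ n →
        τ.D ρ ((e₂.trans (IMap.cons (κ := .n) (.size (.var .z)) s.wk.wk) t.lift.lift).den
            (Env.cons l₁ (Env.cons a θ₁)))
          ((e₂.trans (IMap.cons (κ := .n) (.size (.var .z)) s.wk.wk) t.lift.lift).den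
            (Env.cons l₂ (Env.cons b θ₂))) ≤
        Δ₁.cost ρ (t.env θ₁) (t.env θ₂) + dmul (R.den ρ) ((σ.subst ISub.wk).D (ρ.cons n) a b +
          (DTy.list (σ.subst ISub.wk) (.var .z)).D (ρ.cons n) l₁ l₂) := by
      intro n a b l₁ l₂ hl₁ hl₂ hS
      have hs : ∀ (θ : Env Ξ) (a : A.den) (l : (Ty.list A).den), s.env θ = ρ → List.length l = n →
          (IMap.cons (κ := .n) (.size (.var .z)) s.wk.wk).env (Env.cons l (Env.cons a θ)) =
            ρ.cons n := fun θ a l h hl =>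
        (IMap.env_cons _ _ _).trans (congrArg₂ IEnv.cons hl
          ((IMap.env_wk _ _ _).trans ((IMap.env_wk _ _ _).trans h)))
      have hsat : (S.subst (ISub.wk (κ := .n))).den (ρ.cons n) = Nat.succ n :=
        (Size.den_subst _ _ _).trans ((congrArg (Size.den · S) (ISub.env_wk n ρ)).trans hS)
      have := ih₂ _ _ he.2.2 (Env.cons l₁ (Env.cons a θ₁)) (Env.cons l₂ (Env.cons b θ₂))
        (ρ.cons n) (hs θ₁ a l₁ h₁ hl₁) (hs θ₂ b l₂ h₂ hl₂)
        (Constrs.sat_add (Constrs.sat_wk hρ n) hsat)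
      rw [Sub.env_lift_lift, Sub.env_lift_lift, DCtx.cost_cons, DCtx.cost_cons, DTy.D_wk,
        Sens.den_subst, ISub.env_wk] at this
      refine this.trans ?_
      rw [dmul_add, add_comm (dmul _ _), add_comm (dmul _ _), add_assoc]
      exact add_le_add_left (DCtx.cost_wk _ _ _ _ _) _
    simp only [DExp.trans, Tm.den]
    generalize (e.trans s t).den θ₁ = l₁, (e.trans s t).den θ₂ = l₂ at hl₁ hl₂
    match l₁, l₂, hl₁, hl₂ with
    | [], [], hl₁, _ => exact (ih₁' (Constrs.sat_add hρ hl₁.symm)).trans le_self_add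
    | [], _ :: _, hl₁, hl₂ => exact absurd (hl₁.trans hl₂.symm) (Nat.succ_ne_zero _).symm
    | _ :: _, [], hl₁, hl₂ => exact absurd (hl₁.trans hl₂.symm) (Nat.succ_ne_zero _)
    | a :: l₁, b :: l₂, hl₁, hl₂ =>
      refine (ih₂' l₁.length a b l₁ l₂ rfl (Nat.succ.inj (hl₂.trans hl₁.symm)) hl₁.symm).trans_eq ?_
      exact congrArg (fun d => _ + dmul _ d)
        (DTy.D_list_cons hl₁.symm (DTy.D_wk _ _ _).symm a b l₁ l₂).symm
  | sub _ hσ hΔ ih =>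
    exact fun s t he θ₁ θ₂ ρ h₁ h₂ hρ => (hσ.D_le hρ _ _).trans
      ((ih s t he θ₁ θ₂ ρ h₁ h₂ hρ).trans
        (DCtx.cost_mono fun B x => entryCost_mono hρ (hΔ B x) _ _))

/-! ### Differential privacy of DFuzz programs -/

theorem IEnv.eq_nil (ρ : IEnv []) : ρ = IEnv.nil := by
  funext κ i
  cases i

/-- On adjacent inputs the output distributions are at distance at most `ε`. -/
theorem DTyping.D_M_le {A : Ty} {ε : Sens []} {τ : DTy [] A}
    {e : DExp [] [A] (.M .real)} (hterm : e.star.SimplyTyped)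
    (he : DTyping (φ := []) [] (DCtx.cons ε τ DCtx.empty) e .M) (θ₁ θ₂ : Env [A])
    (h : τ.dist (θ₁ A .z) (θ₂ A .z) ≤ 1) :
    (DTy.M (φ := [])).D IEnv.nil (e.star.den θ₁) (e.star.den θ₂) ≤ ε.den IEnv.nil := by
  refine (he.D_le_cost IMap.nil Sub.id hterm θ₁ θ₂ IEnv.nil (IEnv.eq_nil _) (IEnv.eq_nil _)
    (List.forall_mem_nil _)).trans ?_
  refine (add_zero _).le.trans ((dmul_mono le_rfl h).trans ?_)
  rw [dmul_of_ne_top _ ENNReal.one_ne_top, mul_one]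

theorem toOuterMeasure_le_of_forall_le {α : Type} {μ ν : PMF α} {c : ℝ≥0∞} (h : ∀ x, μ x ≤ c * ν x)
    (E : Set α) : μ.toOuterMeasure E ≤ c * ν.toOuterMeasure E := by
  rw [PMF.toOuterMeasure_apply, PMF.toOuterMeasure_apply, ← ENNReal.tsum_mul_left]
  refine ENNReal.tsum_le_tsum fun x => ?_
  by_cases hx : x ∈ E <;> simp [hx, h]

end HOARe

theorem mainTheorem4 {A : HOARe.Ty} (ε : HOARe.Sens []) (τ : HOARe.DTy [] A)
    (e : HOARe.DExp [] [A] (.M .real))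
    (hε : ε.den HOARe.IEnv.nil ≠ ⊤)
    (hterm : e.star.SimplyTyped)
    (he : HOARe.DTyping (φ := []) [] (HOARe.DCtx.cons ε τ HOARe.DCtx.empty) e .M) :
    HOARe.RTyping (HOARe.RCtx.bind .nil (HOARe.adjacentTy τ)) e.star e.star
        (HOARe.privateTy ε) ∧
      HOARe.DifferentiallyPrivate (α := A.den) (β := ℝ)
        (fun v₁ v₂ => τ.dist v₁ v₂ ≤ 1)
        (ε.den HOARe.IEnv.nil).toNNReal 0
        (fun v => e.star.den (HOARe.Env.cons v HOARe.Env.nil)) := by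
  open HOARe in
  refine ⟨hterm.rtyping_of_valid fun θ hθ => ?_, fun v₁ v₂ hv E => ?_⟩
  · have hd : τ.dist (θ.left A .z) (θ.right A .z) ≤ 1 :=
      (congrArg (fun ρ => τ.D ρ (θ A .z) (θ A (.s .z))) (IEnv.eq_nil _).symm).trans_le hθ.2.2
    have h := he.D_M_le hterm _ _ hd
    have hs : (ε.star : Tm (dbl [A]) .ereal).den θ = ε.den IEnv.nil :=
      (Sens.den_trans _ _ _).trans (congrArg (Sens.den · ε) (IEnv.eq_nil _))
    show Lifting ((ε.star : Tm (dbl [A]) .ereal).den θ) 0 _ _ _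
    rw [hs]
    exact Lifting.eq_of_iSup_absLogRatio_le hε (fun a => ⟨trivial, rfl⟩) h
  · have h := (iSup_absLogRatio_le_iff hε).1
      (he.D_M_le hterm (Env.cons v₁ Env.nil) (Env.cons v₂ Env.nil) hv)
    rw [ENNReal.coe_zero, add_zero]
    refine (toOuterMeasure_le_of_forall_le (fun x => (h x).1) E).trans_eq ?_
    rw [eexp_of_ne_top hε]
    rfl
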